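/- Let $a,b,c,d\in\mathbb R$, put $\delta=c+d-a-b$, and assume $$a,b,\delta>0,\qquad d-a,\;d-b,\;c+1-a,\;c-b\notin-\mathbb N_0$$ (so that the hypergeometric system below is perfect) together with $$d>\max(a,b),\qquad c\ge a,\qquad c+1\ge b$$ (so that its Jacobi matrix is nonnegative). On $[0,1]$ consider $$\mathrm d\mu(x)=\frac{\Gamma(c)\Gamma(d)}{\Gamma(a)\Gamma(b)\Gamma(\delta)}x^{a-1}(1-x)^{\delta-1}\,\mathrm dx,\quad w_1(x)={}_2F_1(c-b,d-b;\delta;1-x),\quad w_2(x)=\tfrac cb\,{}_2F_1(c-b,d-b-1;\delta;1-x).$$ With $\xi=(w_1,w_2,xw_1,xw_2,x^2w_1,\dots)^\top$ and $X=(1,x,x^2,\dots)^\top$, the entries of the moment matrix $g=\int X\xi^\top\mathrm d\mu$ are convergent integrals, and $g$ has a unique Gauss--Borel factorization $g=S^{-1}H\tilde S^{-\top}$ with $S,\tilde S$ lower unitriangular and $H=\operatorname{diag}(H_0,H_1,\dots)$, all $H_n\ne0$. Let $B=SX$ be the monic type II multiple orthogonal polynomials, $A_1=H^{-1}\tilde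 S(1,0,x,0,x^2,\dots)^\top$, $A_2=H^{-1}\tilde S(0,1,0,x,0,\dots)^\top$, $q^{(n)}=w_1A_1^{(n)}+w_2A_2^{(n)}$ the type I linear forms, and $J=S\Lambda S^{-1}$ the Jacobi matrix, where $\Lambda$ is the shift matrix with ones on the first superdiagonal. The only possibly nonzero entries of $J$ are, for $n\in\mathbb N_0$, $J_{n,n+1}=1$ and $$J_{n,n}=\beta_n=\lambda_{3n}+\lambda_{3n+1}+\lambda_{3n+2},\quad J_{n+1,n}=\alpha_{n+1}=(\lambda_{3n+1}+\lambda_{3n+2})\lambda_{3n+3}+\lambda_{3n+2}\lambda_{3n+4},\quad J_{n+2,n}=\gamma_{n+1}=\lambda_{3n+2}\lambda_{3n+4}\lambda_{3n+6},$$ where, with $c_{2k-1}=c+k$ and $c_{2k}=d+k$, $\lambda_0=\lambda_1=0$, $\lambda_2=\frac{ab}{cd}$ and for $n\ge1$ $$\lambda_{3n}=\tfrac{n(b+n-1)(c_n-a-1)}{(c_n+n-2)(c_n+n-1)(c_{n-1}+n-1)},\quad \lambda_{3n+1}=\tfrac{n(a+n)(c_{n-1}-b)}{(c_n+n-1)(c_{n-1}+n-1)(c_{n-1}+n)},\quad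 \lambda_{3n+2}=\tfrac{(a+n)(b+n)(c_n-1)}{(c_n+n-1)(c_n+n)(c_{n-1}+n)},$$ and all entries of $J$ are nonnegative. Moreover: (i) If for every $n$ the zeros of $B^{(n)}$ lie in $(0,1)$, then $B^{(n)}(1)>0$ for all $n$, and $P_{II}=\sigma_{II}J\sigma_{II}^{-1}$ with $\sigma_{II}=\operatorname{diag}(1/B^{(n)}(1))$ is a stochastic matrix (nonnegative entries, rows summing to $1$), whose only possibly nonzero entries are $$P_{II,n,n+1}=\tfrac{B^{(n+1)}(1)}{B^{(n)}(1)},\quad P_{II,n,n}=\beta_n,\quad P_{II,n+1,n}=\tfrac{B^{(n)}(1)}{B^{(n+1)}(1)}\alpha_{n+1},\quad P_{II,n+2,n}=\tfrac{B^{(n)}(1)}{B^{(n+2)}(1)}\gamma_{n+1}.$$ (ii) One has, in terms of the Pochhammer symbols $(u)_k=u(u+1)\cdots(u+k-1)$, $$q^{(2n)}(1)=\tfrac{1}{(2n)!}\tfrac{(c)_{3n}(d)_{3n}}{(a)_{2n}(b)_{2n}}>0,\qquad q^{(2n+1)}(1)=\tfrac1{(2n+1)!}\tfrac{(c)_{3n+2}(d)_{3n+1}}{(a)_{2n+1}(b)_{2n+1}}>0,$$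 and $P_I=\sigma_IJ^\top\sigma_I^{-1}$ with $\sigma_I=\operatorname{diag}(1/q^{(n)}(1))$ is a stochastic matrix, whose only possibly nonzero entries are $$P_{I,n,n+2}=\tfrac{q^{(n+2)}(1)}{q^{(n)}(1)}\gamma_{n+1},\quad P_{I,n,n+1}=\tfrac{q^{(n+1)}(1)}{q^{(n)}(1)}\alpha_{n+1},\quad P_{I,n,n}=\beta_n,\quad P_{I,n+1,n}=\tfrac{q^{(n)}(1)}{q^{(n+1)}(1)}.$$ Hence these are random walk multiple orthogonal polynomials: for all $x$ at which the series defining $w_1,w_2$ converge, in particular on $(0,1]$, the type I functions $r_n(x)=q^{(n)}(x)/q^{(n)}(1)$ satisfy $r_n(1)=1$ and $x\,r_n(x)=\sum_mP_{I,n,m}r_m(x)$ and, under the hypothesis of (i), the polynomials $R_n(x)=B^{(n)}(x)/B^{(n)}(1)$ satisfy $R_n(1)=1$ and, for all real $x$, $x\,R_n(x)=\sum_mP_{II,n,m}R_m(x)$. -/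

import Mathlib

open MeasureTheory Polynomial

/-! ## Semi-infinite matrices -/

/-- Product of two semi-infinite matrices. In every product formed below, each entry is a sum with
only finitely many nonzero terms. -/
noncomputable def semiMul (A B : Matrix ℕ ℕ ℝ) : Matrix ℕ ℕ ℝ :=
  Matrix.of fun i j => ∑ᶠ k, A i k * B k j

/-- Lower unitriangular semi-infinite matrices. -/
def IsLowerUnitriangular (S : Matrix ℕ ℕ ℝ) : Prop :=
  (∀ i, S i i = 1) ∧ ∀ i j, i < j → S i j = 0

/-- Entries of the inverse of a lower unitriangular semi-infinite matrix, by forward substitution: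
the entry in row `i` and column `j` is `δ_{ij} - ∑_{k < i} S_{i k} (S⁻¹)_{k j}`. -/
noncomputable def lowerInvEntry (S : Matrix ℕ ℕ ℝ) (i j : ℕ) : ℝ :=
  (if i = j then 1 else 0) - ∑ k : Fin i, S i k * lowerInvEntry S k j
termination_by i
decreasing_by exact k.2

/-- The inverse of a lower unitriangular semi-infinite matrix. -/
noncomputable def lowerInv (S : Matrix ℕ ℕ ℝ) : Matrix ℕ ℕ ℝ := Matrix.of (lowerInvEntry S)

theorem lowerInv_isLowerUnitriangular (S : Matrix ℕ ℕ ℝ) :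
    IsLowerUnitriangular (lowerInv S) := by
  have h0 : ∀ i j, i < j → lowerInvEntry S i j = 0 := by
    intro i
    induction i using Nat.strong_induction_on with
    | _ i ih =>
      intro j hij
      rw [lowerInvEntry, if_neg hij.ne, Finset.sum_eq_zero, sub_zero]
      intro k _
      rw [ih k k.2 j (k.2.trans hij), mul_zero]
  refine ⟨fun i => ?_, fun i j hij => by rw [lowerInv, Matrix.of_apply, h0 i j hij]⟩
  rw [lowerInv, Matrix.of_apply, lowerInvEntry, if_pos rfl, Finset.sum_eq_zero, sub_zero]
  intro k _
  rw [h0 k i k.2, mul_zero]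

theorem semiMul_lowerInv (S : Matrix ℕ ℕ ℝ) (hS : IsLowerUnitriangular S) :
    semiMul S (lowerInv S) = 1 := by
  ext i j
  have hsub : (Function.support fun k => S i k * lowerInvEntry S k j) ⊆
      ((Finset.range (i + 1) : Finset ℕ) : Set ℕ) := by
    intro k hk
    by_contra hlt
    simp only [Finset.coe_range, Set.mem_Iio, not_lt] at hlt
    exact hk (by simp only [hS.2 i k (by omega), zero_mul])
  have e := lowerInvEntry.eq_def S i j
  simp only [semiMul, lowerInv, Matrix.of_apply]
  rw [finsum_eq_sum_of_support_subset _ hsub, Finset.sum_range_succ, hS.1, one_mul,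
    Finset.sum_range, Matrix.one_apply, e]
  ring

/-- The shift matrix, with ones on the first superdiagonal. -/
def shiftMatrix : Matrix ℕ ℕ ℝ := Matrix.of fun i j => if j = i + 1 then 1 else 0

/-- A Gauss--Borel factorization `g = S⁻¹ H S̃⁻ᵀ` of a semi-infinite matrix `g`, with `S`, `S̃` lower
unitriangular and `H` diagonal with nonzero diagonal entries. -/
structure GaussBorel (g : Matrix ℕ ℕ ℝ) where
  S : Matrix ℕ ℕ ℝ
  H : ℕ → ℝ
  St : Matrix ℕ ℕ ℝ
  S_lower : IsLowerUnitriangular S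
  St_lower : IsLowerUnitriangular St
  H_ne_zero : ∀ n, H n ≠ 0
  factorization :
    g = semiMul (semiMul (lowerInv S) (Matrix.diagonal H)) (Matrix.transpose (lowerInv St))

/-- A semi-infinite matrix is stochastic: its entries are nonnegative and its rows sum to one. -/
def IsStochastic (P : Matrix ℕ ℕ ℝ) : Prop :=
  (∀ n m, 0 ≤ P n m) ∧ ∀ n, HasSum (fun m => P n m) 1

/-- The functions `R 0, R 1, …`, normalized to be `1` at unity, form a random walk system with
transition matrix `P`: the matrix `P` is stochastic with rows of finite support, and
`x R_n(x) = ∑_m P_{n m} R_m(x)`. -/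
def IsRandomWalkSystem (P : Matrix ℕ ℕ ℝ) (R : ℕ → ℝ → ℝ) : Prop :=
  IsStochastic P ∧ (∀ n, {m | P n m ≠ 0}.Finite) ∧ (∀ n, R n 1 = 1) ∧
    ∀ n x, ∑ᶠ m, P n m * R m x = x * R n x

/-! ## Multiple orthogonal polynomials on the step-line -/

namespace GaussBorel

variable {g : Matrix ℕ ℕ ℝ}

/-- The monic type II polynomials: `B = S X` with `X = (1, x, x², …)ᵀ`. -/
noncomputable def B (F : GaussBorel g) (n : ℕ) : ℝ[X] :=
  ∑ i ∈ Finset.range (n + 1), C (F.S n i) * X ^ i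

/-- The type I polynomials `A₁ = H⁻¹ S̃ X₁` with `X₁ = (1, 0, x, 0, x², …)ᵀ`. -/
noncomputable def A₁ (F : GaussBorel g) (n : ℕ) : ℝ[X] :=
  C (F.H n)⁻¹ * ∑ j ∈ Finset.range (n + 1), if Even j then C (F.St n j) * X ^ (j / 2) else 0

/-- The type I polynomials `A₂ = H⁻¹ S̃ X₂` with `X₂ = (0, 1, 0, x, 0, x², …)ᵀ`. -/
noncomputable def A₂ (F : GaussBorel g) (n : ℕ) : ℝ[X] :=
  C (F.H n)⁻¹ * ∑ j ∈ Finset.range (n + 1), if Even j then 0 else C (F.St n j) * X ^ (j / 2)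

/-- The Jacobi matrix `J = S Λ S⁻¹`. -/
noncomputable def jacobi (F : GaussBorel g) : Matrix ℕ ℕ ℝ :=
  semiMul (semiMul F.S shiftMatrix) (lowerInv F.S)

end GaussBorel

/-! ## The hypergeometric system -/

/-- The measure
`Γ(c)Γ(d) / (Γ(a)Γ(b)Γ(δ)) x^(a-1) (1-x)^(δ-1) dx` on `[0,1]`, with `δ = c + d - a - b`. -/
noncomputable def hgMeasure (a b c d : ℝ) : Measure ℝ :=
  (volume.restrict (Set.Icc 0 1)).withDensity fun x => ENNReal.ofReal
    (Real.Gamma c * Real.Gamma d / (Real.Gamma a * Real.Gamma b * Real.Gamma (c + d - a - b))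
      * x ^ (a - 1) * (1 - x) ^ (c + d - a - b - 1))

/-- The weight `w₁(x) = ₂F₁(c-b, d-b; δ; 1-x)`. -/
noncomputable def hgW₁ (a b c d x : ℝ) : ℝ :=
  ordinaryHypergeometric (c - b) (d - b) (c + d - a - b) (1 - x)

/-- The weight `w₂(x) = (c/b) ₂F₁(c-b, d-b-1; δ; 1-x)`. -/
noncomputable def hgW₂ (a b c d x : ℝ) : ℝ :=
  c / b * ordinaryHypergeometric (c - b) (d - b - 1) (c + d - a - b) (1 - x)

/-- The undressed linear forms `ξ = (w₁, w₂, x w₁, x w₂, x² w₁, x² w₂, …)`. -/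
noncomputable def hgXi (a b c d : ℝ) (m : ℕ) (x : ℝ) : ℝ :=
  x ^ (m / 2) * if Even m then hgW₁ a b c d x else hgW₂ a b c d x

/-- The moment matrix `g = ∫ X ξᵀ dμ`. -/
noncomputable def hgMoment (a b c d : ℝ) : Matrix ℕ ℕ ℝ :=
  Matrix.of fun n m => ∫ x, x ^ n * hgXi a b c d m x ∂(hgMeasure a b c d)

/-- `c_{2k-1} = c + k` and `c_{2k} = d + k`. -/
noncomputable def hgC (c d : ℝ) (n : ℕ) : ℝ :=
  if Even n then d + (n / 2 : ℕ) else c + ((n + 1) / 2 : ℕ)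

/-- The coefficients `λ_m`. At `m = 0, 1, 2` the general fractions contain
the parameter-independent zero factor `n = 0` or the common factor `d - 1` in numerator and
denominator; the values below are the ones after simplification. -/
noncomputable def hgLambda (a b c d : ℝ) (m : ℕ) : ℝ :=
  let n : ℕ := m / 3
  let e : ℝ := hgC c d n
  let e' : ℝ := hgC c d (n - 1)
  if n = 0 then
    if m = 2 then a * b / (c * d) else 0
  else if m % 3 = 0 then
    n * (b + n - 1) * (e - a - 1) / ((e + n - 2) * (e + n - 1) * (e' + n - 1))
  else if m % 3 = 1 then
    n * (a + n) * (e' - b) / ((e + n - 1) * (e' + n - 1) * (e' + n))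
  else
    (a + n) * (b + n) * (e - 1) / ((e + n - 1) * (e + n) * (e' + n))

/-- The diagonal Jacobi coefficient `β_n`. -/
noncomputable def hgBeta (a b c d : ℝ) (n : ℕ) : ℝ :=
  hgLambda a b c d (3 * n) + hgLambda a b c d (3 * n + 1) + hgLambda a b c d (3 * n + 2)

/-- The Jacobi coefficient `α_{n+1}` on the first subdiagonal. -/
noncomputable def hgAlphaSucc (a b c d : ℝ) (n : ℕ) : ℝ :=
  (hgLambda a b c d (3 * n + 1) + hgLambda a b c d (3 * n + 2)) * hgLambda a b c d (3 * n + 3)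
    + hgLambda a b c d (3 * n + 2) * hgLambda a b c d (3 * n + 4)

/-- The Jacobi coefficient `γ_{n+1}` on the second subdiagonal. -/
noncomputable def hgGammaSucc (a b c d : ℝ) (n : ℕ) : ℝ :=
  hgLambda a b c d (3 * n + 2) * hgLambda a b c d (3 * n + 4) * hgLambda a b c d (3 * n + 6)

/-- The Pochhammer symbol `(x)_n`. -/
noncomputable def hgPoch (x : ℝ) (n : ℕ) : ℝ := (ascPochhammer ℝ n).eval x

namespace GaussBorel

variable {a b c d : ℝ}

/-- The type I linear form `q^{(n)} = w₁ A₁^{(n)} + w₂ A₂^{(n)}`. -/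
noncomputable def q (F : GaussBorel (hgMoment a b c d)) (n : ℕ) (x : ℝ) : ℝ :=
  hgW₁ a b c d x * (F.A₁ n).eval x + hgW₂ a b c d x * (F.A₂ n).eval x

/-- `P_II = σ_II J σ_II⁻¹`, with `σ_II = diag(1 / B^{(n)}(1))`. -/
noncomputable def PII (F : GaussBorel (hgMoment a b c d)) : Matrix ℕ ℕ ℝ :=
  semiMul (semiMul (Matrix.diagonal fun n => 1 / (F.B n).eval 1) F.jacobi)
    (Matrix.diagonal fun n => (F.B n).eval 1)

/-- `P_I = σ_I Jᵀ σ_I⁻¹`, with `σ_I = diag(1 / q^{(n)}(1))`. -/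
noncomputable def PI (F : GaussBorel (hgMoment a b c d)) : Matrix ℕ ℕ ℝ :=
  semiMul (semiMul (Matrix.diagonal fun n => 1 / F.q n 1) (Matrix.transpose F.jacobi))
    (Matrix.diagonal fun n => F.q n 1)

end GaussBorel

/-! Everything reduces to explicit coefficient identities; integrals enter only through the first
two columns of `g`. Term-by-term integration against Beta densities turns the moments of w₁ and w₂
into values ₂F₁(·,·;·;1), which Gauss's theorem `tsum_gaussTerm` sums to (a)_n(b)_n/((c)_n(d)_n) and
to the same quotient with b and c raised by one. The other columns follow from ξ_{m+2} = x ξ_m.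

The candidates for the type II polynomials are the monic ₃F₂ of `hgTypeII`. Against the first two
columns their orthogonality says that an N-th finite difference kills a polynomial of degree below
N. The contiguity relations of `hgTypeII_factorization` read B = L₁Q, Q = L₂R, xR = UB with
bidiagonal L₁, L₂, U whose entries are ones and the λ's. Hence xB = (L₁L₂U)B, and L₁L₂U is the
tetradiagonal matrix of the β, α, γ, nonnegative because the λ's are. This recurrence carries the
triangularity of S g from two columns to all of them, with H_{n+2} = γ_{n+1}H_n, so the
factorization exists; it is unique for the usual triangular reason, and J = L₁L₂U because J is the
only row finite solution of TS = SΛ.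

By duality the type I forms satisfy Jᵀq = xq (`semiMul_transpose_jacobi_typeI`). At x = 1 the
explicit product `typeIValue` solves the same recurrence (`typeIValue_recurrence`), and since γ > 0
two initial values determine the solution. A monic polynomial whose roots all lie below 1 is
positive at 1. With positive values at 1, dividing by them turns J and Jᵀ into stochastic matrices:
the row sums are the recurrences at x = 1. -/

/-! ## Algebra of semi-infinite matrices -/

/-- Every row has finite support. -/
def RowFinite (A : Matrix ℕ ℕ ℝ) : Prop := ∀ i, {k | A i k ≠ 0}.Finite

theorem semiMul_eq_sum (A B : Matrix ℕ ℕ ℝ) {i : ℕ} (j : ℕ) (s : Finset ℕ)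
    (h : ∀ k, k ∉ s → A i k = 0) : semiMul A B i j = ∑ k ∈ s, A i k * B k j := by
  refine finsum_eq_sum_of_support_subset _ fun k hk => ?_
  by_contra hks
  exact hk (by simp only [h k hks, zero_mul])

theorem RowFinite.semiMul_apply {A : Matrix ℕ ℕ ℝ} (hA : RowFinite A) (B : Matrix ℕ ℕ ℝ)
    (i j : ℕ) : semiMul A B i j = ∑ k ∈ (hA i).toFinset, A i k * B k j :=
  semiMul_eq_sum A B j _ fun k hk => by simpa using hk

/-- Finite rows of `A` and `B` confine both summations to finite sets, so they can be interchanged.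
Nothing is needed of `C`, which allows `C` to be the full moment matrix or a transpose. -/
theorem semiMul_assoc {A B : Matrix ℕ ℕ ℝ} (hA : RowFinite A) (hB : RowFinite B)
    (C : Matrix ℕ ℕ ℝ) : semiMul (semiMul A B) C = semiMul A (semiMul B C) := by
  classical
  ext i j
  set s := (hA i).toFinset
  set t := s.biUnion fun k => (hB k).toFinset
  have ht : ∀ k ∈ s, ∀ l, l ∉ t → B k l = 0 := by
    intro k hk l hl
    by_contra h
    exact hl (Finset.mem_biUnion.2 ⟨k, hk, by simpa using h⟩)
  have hAB : ∀ l, semiMul A B i l = ∑ k ∈ s, A i k * B k l := hA.semiMul_apply B i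
  rw [semiMul_eq_sum _ C j t, hA.semiMul_apply]
  · simp only [hAB, Finset.sum_mul]
    rw [Finset.sum_comm]
    refine Finset.sum_congr rfl fun k hk => ?_
    rw [semiMul_eq_sum B C j t (ht k hk), Finset.mul_sum]
    exact Finset.sum_congr rfl fun l _ => mul_assoc _ _ _
  · intro l hl
    rw [hAB]
    exact Finset.sum_eq_zero fun k hk => by rw [ht k hk l hl, mul_zero]

theorem RowFinite.semiMul {A B : Matrix ℕ ℕ ℝ} (hA : RowFinite A) (hB : RowFinite B) :
    RowFinite (semiMul A B) := by
  classical
  intro i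
  refine ((hA i).toFinset.biUnion fun k => (hB k).toFinset).finite_toSet.subset fun l hl => ?_
  by_contra h
  refine hl ?_
  rw [hA.semiMul_apply]
  refine Finset.sum_eq_zero fun k hk => ?_
  by_contra hkl
  refine h (Finset.mem_coe.2 (Finset.mem_biUnion.2 ⟨k, hk, ?_⟩))
  simpa using (mul_ne_zero_iff.1 hkl).2

theorem rowFinite_of_eq_zero {A : Matrix ℕ ℕ ℝ} (f : ℕ → ℕ) (h : ∀ i j, f i < j → A i j = 0) :
    RowFinite A := fun i => (Set.finite_Iic (f i)).subset fun k hk => by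
  by_contra hlt
  exact hk (h i k (not_le.1 hlt))

theorem IsLowerUnitriangular.rowFinite {S : Matrix ℕ ℕ ℝ} (hS : IsLowerUnitriangular S) :
    RowFinite S := rowFinite_of_eq_zero id hS.2

theorem rowFinite_diagonal (D : ℕ → ℝ) : RowFinite (Matrix.diagonal D) :=
  rowFinite_of_eq_zero id fun _ _ h => Matrix.diagonal_apply_ne _ h.ne

theorem rowFinite_shiftMatrix : RowFinite shiftMatrix :=
  rowFinite_of_eq_zero (· + 1) fun i j h => by
    simp only [shiftMatrix, Matrix.of_apply]
    rw [if_neg (by omega)]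

theorem semiMul_diagonal_left (D : ℕ → ℝ) (A : Matrix ℕ ℕ ℝ) (i j : ℕ) :
    semiMul (Matrix.diagonal D) A i j = D i * A i j := by
  rw [semiMul_eq_sum _ A j {i} fun k hk => Matrix.diagonal_apply_ne _ (by simpa [eq_comm] using hk)]
  simp

theorem semiMul_diagonal_right (D : ℕ → ℝ) (A : Matrix ℕ ℕ ℝ) (i j : ℕ) :
    semiMul A (Matrix.diagonal D) i j = A i j * D j := by
  rw [semiMul, Matrix.of_apply, finsum_eq_single _ j fun k hk => by
    rw [Matrix.diagonal_apply_ne _ hk, mul_zero], Matrix.diagonal_apply_eq]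

theorem one_semiMul (A : Matrix ℕ ℕ ℝ) : semiMul 1 A = A := by
  ext i j
  rw [← Matrix.diagonal_one, semiMul_diagonal_left, one_mul]

theorem semiMul_one (A : Matrix ℕ ℕ ℝ) : semiMul A 1 = A := by
  ext i j
  rw [← Matrix.diagonal_one, semiMul_diagonal_right, mul_one]

theorem semiMul_shiftMatrix_left (A : Matrix ℕ ℕ ℝ) (i j : ℕ) :
    semiMul shiftMatrix A i j = A (i + 1) j := by
  rw [semiMul_eq_sum _ A j {i + 1} fun k hk => ?_]
  · simp [shiftMatrix]
  · simp only [Finset.mem_singleton] at hk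
    simp [shiftMatrix, hk]

theorem semiMul_transpose (A B : Matrix ℕ ℕ ℝ) :
    semiMul A.transpose B.transpose = (semiMul B A).transpose := by
  ext i j
  simp only [semiMul, Matrix.of_apply, Matrix.transpose_apply, mul_comm]

theorem IsLowerUnitriangular.semiMul_eq_sum {S : Matrix ℕ ℕ ℝ} (hS : IsLowerUnitriangular S)
    (A : Matrix ℕ ℕ ℝ) (i j : ℕ) :
    semiMul S A i j = ∑ k ∈ Finset.range (i + 1), S i k * A k j :=
  _root_.semiMul_eq_sum S A j _ fun k hk => hS.2 i k (by simpa using hk)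

theorem IsLowerUnitriangular.semiMul {S T : Matrix ℕ ℕ ℝ} (hS : IsLowerUnitriangular S)
    (hT : IsLowerUnitriangular T) : IsLowerUnitriangular (semiMul S T) := by
  refine ⟨fun i => ?_, fun i j hij => ?_⟩
  · rw [hS.semiMul_eq_sum, Finset.sum_range_succ, hS.1, hT.1, Finset.sum_eq_zero, zero_add, one_mul]
    intro k hk
    rw [hT.2 k i (Finset.mem_range.1 hk), mul_zero]
  · rw [hS.semiMul_eq_sum]
    refine Finset.sum_eq_zero fun k hk => ?_
    rw [hT.2 k j ((Finset.mem_range_succ_iff.1 hk).trans_lt hij), mul_zero]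

/-- A right inverse that has a right inverse itself is two-sided; this is what turns forward
substitution into a left inverse. -/
theorem lowerInv_lowerInv {S : Matrix ℕ ℕ ℝ} (hS : IsLowerUnitriangular S) :
    lowerInv (lowerInv S) = S := by
  have h := lowerInv_isLowerUnitriangular S
  rw [← one_semiMul (lowerInv (lowerInv S)), ← semiMul_lowerInv S hS,
    semiMul_assoc hS.rowFinite h.rowFinite, semiMul_lowerInv _ h, semiMul_one]

theorem lowerInv_semiMul {S : Matrix ℕ ℕ ℝ} (hS : IsLowerUnitriangular S) :
    semiMul (lowerInv S) S = 1 := by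
  have h := semiMul_lowerInv _ (lowerInv_isLowerUnitriangular S)
  rwa [lowerInv_lowerInv hS] at h

/-! ## Gauss--Borel factorizations -/

namespace GaussBorel

variable {g : Matrix ℕ ℕ ℝ}

/-- Multiplying the factorization by S leaves H S̃⁻ᵀ, so S g is upper triangular with diagonal H.
The factorization is used later in this form. -/
theorem semiMul_S_apply (F : GaussBorel g) (n m : ℕ) :
    semiMul F.S g n m = F.H n * lowerInv F.St m n := by
  have hL := lowerInv_isLowerUnitriangular F.S
  rw [congrArg (semiMul F.S) F.factorization, semiMul_assoc hL.rowFinite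
    (rowFinite_diagonal _), ← semiMul_assoc F.S_lower.rowFinite hL.rowFinite, semiMul_lowerInv _ F.S_lower, one_semiMul, semiMul_diagonal_left,
    Matrix.transpose_apply]

theorem semiMul_S_lt (F : GaussBorel g) {n m : ℕ} (h : m < n) : semiMul F.S g n m = 0 := by
  rw [semiMul_S_apply, (lowerInv_isLowerUnitriangular F.St).2 m n h, mul_zero]

theorem semiMul_S_self (F : GaussBorel g) (n : ℕ) : semiMul F.S g n n = F.H n := by
  rw [semiMul_S_apply, (lowerInv_isLowerUnitriangular F.St).1, mul_one]

/-- M = S_G S_F⁻¹ carries the upper triangular S_F g, whose diagonal has no zeros, to the upper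
triangular S_G g. So M is upper triangular as well as lower unitriangular, that is, M = 1. -/
theorem S_unique (F G : GaussBorel g) : G.S = F.S := by
  have hL := lowerInv_isLowerUnitriangular F.S
  set M := semiMul G.S (lowerInv F.S) with hM
  have hMl : IsLowerUnitriangular M := G.S_lower.semiMul hL
  have hMV : semiMul M (semiMul F.S g) = semiMul G.S g := by
    rw [hM, semiMul_assoc G.S_lower.rowFinite hL.rowFinite,
      ← semiMul_assoc hL.rowFinite F.S_lower.rowFinite, lowerInv_semiMul F.S_lower, one_semiMul]
  have hM0 : ∀ n m, m < n → M n m = 0 := by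
    intro n m
    induction m using Nat.strong_induction_on with
    | _ m ih =>
      intro hmn
      have h := G.semiMul_S_lt hmn
      rw [← hMV, hMl.semiMul_eq_sum, Finset.sum_eq_single m, F.semiMul_S_self] at h
      · exact (mul_eq_zero.1 h).resolve_right (F.H_ne_zero m)
      · intro k _ hkm
        rcases lt_or_gt_of_ne hkm with hlt | hgt
        · rw [ih k hlt (hlt.trans hmn), zero_mul]
        · rw [F.semiMul_S_lt hgt, mul_zero]
      · intro hm
        exact absurd (Finset.mem_range.2 (by omega)) hm
  have hM1 : M = 1 := by
    ext n m
    rcases lt_trichotomy m n with h | h | h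
    · rw [hM0 n m h, Matrix.one_apply_ne h.ne']
    · rw [h, hMl.1, Matrix.one_apply_eq]
    · rw [hMl.2 n m h, Matrix.one_apply_ne h.ne]
  calc G.S = semiMul G.S (semiMul (lowerInv F.S) F.S) := by
        rw [lowerInv_semiMul F.S_lower, semiMul_one]
    _ = semiMul M F.S := (semiMul_assoc G.S_lower.rowFinite hL.rowFinite _).symm
    _ = F.S := by rw [hM1, one_semiMul]

theorem unique (F G : GaussBorel g) : G = F := by
  have hS := S_unique F G
  have hH : G.H = F.H := funext fun n => by rw [← semiMul_S_self, ← semiMul_S_self, hS]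
  have hSt : G.St = F.St := by
    rw [← lowerInv_lowerInv G.St_lower, ← lowerInv_lowerInv F.St_lower]
    congr 1
    ext m n
    have h := G.semiMul_S_apply n m
    rw [hS, F.semiMul_S_apply, hH] at h
    exact (mul_left_cancel₀ (F.H_ne_zero n) h).symm
  cases F
  cases G
  simp only at hS hH hSt
  subst hS hH hSt
  rfl

/-- A lower unitriangular `S` for which `S g` is upper triangular with nonzero diagonal provides a
Gauss--Borel factorization of `g`. -/
theorem exists_of_triangular {S : Matrix ℕ ℕ ℝ} (hS : IsLowerUnitriangular S)
    (h0 : ∀ n m, m < n → semiMul S g n m = 0) (hd : ∀ n, semiMul S g n n ≠ 0) :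
    ∃ F : GaussBorel g, F.S = S := by
  -- The factor S̃⁻¹ is forced: its transpose is S g with every row divided by its diagonal entry.
  set L : Matrix ℕ ℕ ℝ := Matrix.of fun m n => (semiMul S g n n)⁻¹ * semiMul S g n m with hLdef
  have hL : IsLowerUnitriangular L :=
    ⟨fun i => inv_mul_cancel₀ (hd i), fun i j hij => by
      rw [hLdef, Matrix.of_apply, h0 j i hij, mul_zero]⟩
  have hI := lowerInv_isLowerUnitriangular S
  refine ⟨⟨S, fun n => semiMul S g n n, lowerInv L, hS, lowerInv_isLowerUnitriangular L, hd, ?_⟩,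
    rfl⟩
  rw [lowerInv_lowerInv hL, semiMul_assoc hI.rowFinite (rowFinite_diagonal _)]
  have h : semiMul (Matrix.diagonal fun n => semiMul S g n n) L.transpose = semiMul S g := by
    ext n m
    rw [semiMul_diagonal_left, Matrix.transpose_apply, hLdef, Matrix.of_apply,
      mul_inv_cancel_left₀ (hd n)]
  rw [h, ← semiMul_assoc hI.rowFinite hS.rowFinite, lowerInv_semiMul hS, one_semiMul]

theorem rowFinite_jacobi (F : GaussBorel g) : RowFinite F.jacobi :=
  (F.S_lower.rowFinite.semiMul rowFinite_shiftMatrix).semiMul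
    (lowerInv_isLowerUnitriangular F.S).rowFinite

/-- The Jacobi matrix is the only row finite solution of `T S = S Λ`. -/
theorem jacobi_eq (F : GaussBorel g) {T : Matrix ℕ ℕ ℝ} (hT : RowFinite T)
    (h : semiMul T F.S = semiMul F.S shiftMatrix) : F.jacobi = T := by
  rw [jacobi, ← h, semiMul_assoc hT F.S_lower.rowFinite, semiMul_lowerInv _ F.S_lower, semiMul_one]

theorem semiMul_jacobi_S (F : GaussBorel g) :
    semiMul F.jacobi F.S = semiMul F.S shiftMatrix := by
  rw [jacobi, semiMul_assoc (F.S_lower.rowFinite.semiMul rowFinite_shiftMatrix)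
    (lowerInv_isLowerUnitriangular F.S).rowFinite, lowerInv_semiMul F.S_lower, semiMul_one]

/-- The matrix `H⁻¹ S̃` of coefficients of the type I linear forms. -/
noncomputable def typeI (F : GaussBorel g) : Matrix ℕ ℕ ℝ :=
  semiMul (Matrix.diagonal fun n => (F.H n)⁻¹) F.St

theorem typeI_apply (F : GaussBorel g) (n j : ℕ) : F.typeI n j = (F.H n)⁻¹ * F.St n j :=
  semiMul_diagonal_left _ _ _ _

theorem rowFinite_typeI (F : GaussBorel g) : RowFinite F.typeI :=
  (rowFinite_diagonal _).semiMul F.St_lower.rowFinite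

/-- If the moment matrix satisfies `Λ g = g (Λᵀ)²`, then `Jᵀ H⁻¹ S̃ = H⁻¹ S̃ Λ²`. -/
theorem semiMul_transpose_jacobi_typeI (F : GaussBorel g) (hg : ∀ n m, g (n + 1) m = g n (m + 2)) :
    semiMul F.jacobi.transpose F.typeI =
      semiMul F.typeI (semiMul shiftMatrix shiftMatrix) := by
  have hLl := lowerInv_isLowerUnitriangular F.St
  -- W = (S g)ᵀ is a two-sided inverse of H⁻¹S̃. The hypothesis on g gives W Jᵀ = (J S g)ᵀ = (S Λ
  -- g)ᵀ = Λ² W, and multiplying by H⁻¹S̃ on both sides gives the claim.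
  set W := semiMul (lowerInv F.St) (Matrix.diagonal F.H) with hW
  have hWf : RowFinite W := hLl.rowFinite.semiMul (rowFinite_diagonal _)
  have hWV : W = (semiMul F.S g).transpose := by
    ext m n
    rw [hW, semiMul_diagonal_right, Matrix.transpose_apply, semiMul_S_apply, mul_comm]
  have hKW : semiMul F.typeI W = 1 := by
    rw [typeI, hW, semiMul_assoc (rowFinite_diagonal _) F.St_lower.rowFinite,
      ← semiMul_assoc F.St_lower.rowFinite hLl.rowFinite, semiMul_lowerInv _ F.St_lower,
      one_semiMul]
    ext i j
    rw [semiMul_diagonal_left]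
    rcases eq_or_ne i j with rfl | h
    · simp [F.H_ne_zero i]
    · simp [h]
  have hWK : semiMul W F.typeI = 1 := by
    rw [typeI, hW, semiMul_assoc hLl.rowFinite (rowFinite_diagonal _),
      ← semiMul_assoc (rowFinite_diagonal _) (rowFinite_diagonal _)]
    have h : semiMul (Matrix.diagonal F.H) (Matrix.diagonal fun n => (F.H n)⁻¹) = 1 := by
      ext i j
      rw [semiMul_diagonal_left]
      rcases eq_or_ne i j with rfl | h
      · simp [F.H_ne_zero i]
      · simp [h]
    rw [h, one_semiMul, lowerInv_semiMul F.St_lower]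
  have hΛ : RowFinite (semiMul shiftMatrix shiftMatrix) :=
    rowFinite_shiftMatrix.semiMul rowFinite_shiftMatrix
  have hWJ : semiMul W F.jacobi.transpose = semiMul (semiMul shiftMatrix shiftMatrix) W := by
    rw [semiMul_assoc rowFinite_shiftMatrix rowFinite_shiftMatrix, hWV, semiMul_transpose,
      ← semiMul_assoc F.rowFinite_jacobi F.S_lower.rowFinite, semiMul_jacobi_S,
      semiMul_assoc F.S_lower.rowFinite rowFinite_shiftMatrix]
    ext m n
    rw [semiMul_shiftMatrix_left, semiMul_shiftMatrix_left, Matrix.transpose_apply,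
      Matrix.transpose_apply, F.S_lower.semiMul_eq_sum, F.S_lower.semiMul_eq_sum]
    exact Finset.sum_congr rfl fun k _ => by rw [semiMul_shiftMatrix_left, hg]
  calc semiMul F.jacobi.transpose F.typeI
      = semiMul (semiMul (semiMul F.typeI W) F.jacobi.transpose) F.typeI := by
        rw [hKW, one_semiMul]
    _ = semiMul (semiMul F.typeI (semiMul (semiMul shiftMatrix shiftMatrix) W)) F.typeI := by
        rw [semiMul_assoc F.rowFinite_typeI hWf, hWJ]
    _ = _ := by
        rw [semiMul_assoc F.rowFinite_typeI (hΛ.semiMul hWf), semiMul_assoc hΛ hWf, hWK,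
          semiMul_one]

theorem typeI_eq_zero (F : GaussBorel g) {n j : ℕ} (h : n < j) : F.typeI n j = 0 := by
  rw [typeI_apply, F.St_lower.2 n j h, mul_zero]

theorem semiMul_sq_shiftMatrix_right (A : Matrix ℕ ℕ ℝ) (n j : ℕ) :
    semiMul A (semiMul shiftMatrix shiftMatrix) n (j + 2) = A n j := by
  rw [semiMul, Matrix.of_apply, finsum_eq_single _ j, semiMul_shiftMatrix_left]
  · simp [shiftMatrix]
  · intro k hk
    rw [semiMul_shiftMatrix_left]
    simp [shiftMatrix, Ne.symm hk]

theorem semiMul_sq_shiftMatrix_right_lt (A : Matrix ℕ ℕ ℝ) (n : ℕ) {j : ℕ} (hj : j < 2) :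
    semiMul A (semiMul shiftMatrix shiftMatrix) n j = 0 := by
  rw [semiMul, Matrix.of_apply]
  refine (finsum_congr fun k => ?_).trans finsum_zero
  rw [semiMul_shiftMatrix_left, shiftMatrix, Matrix.of_apply, if_neg (by omega), mul_zero]

/-- The recurrence `Jᵀ q = x q` for `q = H⁻¹ S̃ e` whenever `Λ² e = x e`. -/
theorem transpose_jacobi_linearForm (F : GaussBorel g) (hg : ∀ n m, g (n + 1) m = g n (m + 2))
    {e : ℕ → ℝ} {x : ℝ} (he : ∀ j, e (j + 2) = x * e j) (n : ℕ) (s : Finset ℕ)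
    (hs : ∀ m, m ∉ s → F.jacobi m n = 0) :
    ∑ m ∈ s, F.jacobi m n * ∑ j ∈ Finset.range (m + 1), F.typeI m j * e j =
      x * ∑ j ∈ Finset.range (n + 1), F.typeI n j * e j := by
  -- All forms that occur are sums over `range N`; the two further indices in `range (N + 2)` make
  -- room for the shift by Λ².
  set N := n + s.sup id + 1 with hN
  have ext : ∀ m M, m < M → ∑ j ∈ Finset.range (m + 1), F.typeI m j * e j =
      ∑ j ∈ Finset.range M, F.typeI m j * e j := fun m M h =>
    Finset.sum_subset (Finset.range_mono h) fun j _ hj => by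
      rw [F.typeI_eq_zero (by simpa using hj), zero_mul]
  have hmN : ∀ m ∈ s, m < N := fun m hm => by
    have : m ≤ s.sup id := Finset.le_sup (f := id) hm
    omega
  have key := F.semiMul_transpose_jacobi_typeI hg
  have hcol : ∀ j, ∑ m ∈ s, F.jacobi m n * F.typeI m j =
      semiMul F.typeI (semiMul shiftMatrix shiftMatrix) n j := fun j => by
    rw [← key, semiMul_eq_sum F.jacobi.transpose F.typeI j s hs]
    rfl
  calc ∑ m ∈ s, F.jacobi m n * ∑ j ∈ Finset.range (m + 1), F.typeI m j * e j
      = ∑ m ∈ s, ∑ j ∈ Finset.range (N + 2), F.jacobi m n * F.typeI m j * e j :=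
        Finset.sum_congr rfl fun m hm => by
          rw [ext m (N + 2) ((hmN m hm).trans (by omega)), Finset.mul_sum]
          exact Finset.sum_congr rfl fun j _ => (mul_assoc _ _ _).symm
    _ = ∑ j ∈ Finset.range (N + 2),
          semiMul F.typeI (semiMul shiftMatrix shiftMatrix) n j * e j := by
        rw [Finset.sum_comm]
        exact Finset.sum_congr rfl fun j _ => by rw [← Finset.sum_mul, hcol]
    _ = ∑ j ∈ Finset.range N, F.typeI n j * (x * e j) := by
        rw [Finset.sum_range_succ', Finset.sum_range_succ',
          semiMul_sq_shiftMatrix_right_lt _ _ (by norm_num),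
          semiMul_sq_shiftMatrix_right_lt _ _ (by norm_num)]
        simp only [zero_mul, add_zero]
        exact Finset.sum_congr rfl fun j _ => by
          rw [← he, ← semiMul_sq_shiftMatrix_right F.typeI n j]
    _ = _ := by
        rw [ext n N (by omega), Finset.mul_sum]
        exact Finset.sum_congr rfl fun j _ => by ring

end GaussBorel

/-! ## Pochhammer symbols -/

theorem hgPoch_zero (x : ℝ) : hgPoch x 0 = 1 := by simp [hgPoch]

theorem hgPoch_succ (x : ℝ) (n : ℕ) : hgPoch x (n + 1) = hgPoch x n * (x + n) :=
  ascPochhammer_succ_eval n x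

theorem hgPoch_add (x : ℝ) (m n : ℕ) : hgPoch x (m + n) = hgPoch x m * hgPoch (x + m) n := by
  simp [hgPoch, ← ascPochhammer_mul]

theorem hgPoch_succ_left (x : ℝ) (n : ℕ) : hgPoch x (n + 1) = x * hgPoch (x + 1) n := by
  rw [add_comm, hgPoch_add, hgPoch_succ, hgPoch_zero]
  simp

theorem hgPoch_pos {x : ℝ} (hx : 0 < x) (n : ℕ) : 0 < hgPoch x n := ascPochhammer_pos n x hx

/-! ## Monic hypergeometric polynomials `₃F₂(-n, e, f; a, b; x)` -/

/-- The coefficient of `x^i` in the monic multiple of `₃F₂(-n, e, f; a, b; x)`. -/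
noncomputable def hyperCoeff (a b e f : ℝ) (n i : ℕ) : ℝ :=
  (-1) ^ (n - i) * (n.choose i : ℝ) *
    (hgPoch (a + i) (n - i) * hgPoch (b + i) (n - i) /
      (hgPoch (e + i) (n - i) * hgPoch (f + i) (n - i)))

theorem hyperCoeff_self (a b e f : ℝ) (n : ℕ) : hyperCoeff a b e f n n = 1 := by
  simp [hyperCoeff, hgPoch_zero]

theorem hyperCoeff_eq_zero (a b e f : ℝ) {n i : ℕ} (h : n < i) : hyperCoeff a b e f n i = 0 := by
  simp [hyperCoeff, Nat.choose_eq_zero_of_lt h]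

theorem hyperCoeff_symm_num (a b e f : ℝ) (n i : ℕ) :
    hyperCoeff a b e f n i = hyperCoeff b a e f n i := by
  simp only [hyperCoeff, mul_comm (hgPoch (a + i) (n - i))]

theorem hyperCoeff_symm_denom (a b e f : ℝ) (n i : ℕ) :
    hyperCoeff a b e f n i = hyperCoeff a b f e n i := by
  simp only [hyperCoeff, mul_comm (hgPoch (e + i) (n - i))]

/-- Simultaneous shift of a numerator and a denominator parameter. -/
theorem hyperCoeff_shift (a b : ℝ) {e f : ℝ} (he : 0 < e) (hf : 0 < f) (n i : ℕ) :
    hyperCoeff a b e f (n + 1) i = hyperCoeff (a + 1) b (e + 1) f (n + 1) i +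
      (n + 1) * (b + n) * (e - a) / ((e + n) * (e + n + 1) * (f + n)) *
        hyperCoeff (a + 1) b f e n i := by
  rcases lt_trichotomy i (n + 1) with h | rfl | h
  -- With n = i + k all Pochhammer symbols and binomials are linear factors times a few common ones.
  -- Once these are generalized, a rational identity remains.
  · obtain ⟨k, rfl⟩ := Nat.exists_eq_add_of_le (Nat.lt_succ_iff.1 h)
    have hk1 : i + k + 1 - i = k + 1 := by omega
    have hk : i + k - i = k := by omega
    have hch : (((i + k + 1).choose i : ℕ) : ℝ) * (k + 1) = ((i + k).choose i : ℕ) * (i + k + 1) := by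
      have := Nat.choose_mul_succ_eq (i + k) i
      rw [hk1] at this
      exact_mod_cast this.symm
    have hi : (0 : ℝ) ≤ i := Nat.cast_nonneg i
    have hE' := hgPoch_succ (e + i) k
    rw [hgPoch_succ_left] at hE'
    simp only [hyperCoeff, hk1, hk, hgPoch_succ_left (a + i), hgPoch_succ_left (e + i),
      hgPoch_succ, add_right_comm _ (1 : ℝ) (i : ℝ)]
    have hE := hgPoch_pos (x := e + i + 1) (by positivity) k
    have hE0 := hgPoch_pos (x := e + i) (by positivity) k
    have hF := hgPoch_pos (x := f + i) (by positivity) k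
    generalize hgPoch (e + i + 1) k = E at *
    generalize hgPoch (e + i) k = E' at *
    generalize hgPoch (f + i) k = F at *
    generalize hgPoch (a + i + 1) k = A at *
    generalize hgPoch (b + i) k = B at *
    generalize (((i + k + 1).choose i : ℕ) : ℝ) = C1 at *
    have hC : (((i + k).choose i : ℕ) : ℝ) = C1 * (k + 1) / (i + k + 1) := by
      rw [hch]
      field_simp
    rw [hC]
    have hE2 : E' = (e + i) * E / (e + i + k) := by
      rw [hE']
      field_simp
    rw [hE2]
    push_cast
    have h1 : e + i + k ≠ 0 := by positivity
    have h2 : e + (i + k) ≠ 0 := by positivity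
    have h3 : f + (i + k) ≠ 0 := by positivity
    have h4 : f + i + k ≠ 0 := by positivity
    have h5 : e + (i + k) + 1 ≠ 0 := by positivity
    have h6 : e + i + 1 + k ≠ 0 := by positivity
    rw [pow_succ]
    field_simp
    ring
  · rw [hyperCoeff_self, hyperCoeff_self, hyperCoeff_eq_zero _ _ _ _ (Nat.lt_succ_self n)]
    ring
  · rw [hyperCoeff_eq_zero _ _ _ _ h, hyperCoeff_eq_zero _ _ _ _ h,
      hyperCoeff_eq_zero _ _ _ _ (by omega)]
    ring

/-- Multiplication by `x`: the coefficients of positive powers. -/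
theorem hyperCoeff_raise (a b : ℝ) {e f : ℝ} (he : 0 < e) (hf : 0 < f) (n i : ℕ) :
    hyperCoeff (a + 1) (b + 1) (e + 1) (f + 1) n i = hyperCoeff a b (e + 1) f (n + 1) (i + 1) +
      (a + n) * (b + n) * e / ((e + n) * (e + n + 1) * (f + n)) * hyperCoeff a b e f n (i + 1) := by
  rcases lt_trichotomy i n with h | rfl | h
  · obtain ⟨k, rfl⟩ := Nat.exists_eq_add_of_le (Nat.succ_le_of_lt h)
    have hk1 : i + 1 + k - i = k + 1 := by omega
    have hk2 : i + 1 + k + 1 - (i + 1) = k + 1 := by omega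
    have hk : i + 1 + k - (i + 1) = k := by omega
    have hch1 : (((i + 1 + k + 1).choose (i + 1) : ℕ) : ℝ) * (i + 1) =
        ((i + 1 + k).choose i : ℕ) * (i + 1 + k + 1) := by
      have := Nat.add_one_mul_choose_eq (i + 1 + k) i
      rw [mul_comm] at this
      exact_mod_cast this.symm
    have hch2 : (((i + 1 + k).choose (i + 1) : ℕ) : ℝ) * (i + 1) =
        ((i + 1 + k).choose i : ℕ) * (k + 1) := by
      have := Nat.choose_succ_right_eq (i + 1 + k) i
      rw [hk1] at this
      exact_mod_cast this
    have hi : (0 : ℝ) ≤ i := Nat.cast_nonneg i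
    have hE' := hgPoch_succ (e + 1 + i) k
    rw [hgPoch_succ_left] at hE'
    have e1 : ∀ x : ℝ, x + ((i + 1 : ℕ) : ℝ) = x + 1 + i := fun x => by push_cast; ring
    have hE1 := hgPoch_succ_left (e + 1 + i) k
    rw [hgPoch_succ] at hE1
    simp only [hyperCoeff, hk1, hk2, hk, e1, hgPoch_succ]
    rw [show e + 1 + 1 + (i : ℝ) = e + 1 + i + 1 by ring]
    have hE := hgPoch_pos (x := e + 1 + i + 1) (by positivity) k
    have hE0 := hgPoch_pos (x := e + 1 + i) (by positivity) k
    have hF := hgPoch_pos (x := f + 1 + i) (by positivity) k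
    generalize hgPoch (e + 1 + i + 1) k = E at *
    generalize hgPoch (e + 1 + i) k = E' at *
    generalize hgPoch (f + 1 + i) k = F at *
    generalize hgPoch (a + 1 + i) k = A at *
    generalize hgPoch (b + 1 + i) k = B at *
    have hC1 : (((i + 1 + k + 1).choose (i + 1) : ℕ) : ℝ) =
        ((i + 1 + k).choose i : ℕ) * (i + 1 + k + 1) / (i + 1) := by
      rw [← hch1]
      field_simp
    have hC2 : (((i + 1 + k).choose (i + 1) : ℕ) : ℝ) =
        ((i + 1 + k).choose i : ℕ) * (k + 1) / (i + 1) := by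
      rw [← hch2]
      field_simp
    rw [hC1, hC2]
    generalize (((i + 1 + k).choose i : ℕ) : ℝ) = C1 at *
    have hE2 : E = E' * (e + 1 + i + k) / (e + 1 + i) := by
      rw [← hE']
      field_simp
    rw [hE2]
    push_cast
    have h1 : e + 1 + i + k ≠ 0 := by positivity
    have h2 : e + (i + 1 + k) ≠ 0 := by positivity
    have h3 : f + (i + 1 + k) ≠ 0 := by positivity
    have h4 : f + 1 + i + k ≠ 0 := by positivity
    have h5 : e + (i + 1 + k) + 1 ≠ 0 := by positivity
    have h6 : e + 1 + i + 1 + k ≠ 0 := by positivity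
    rw [pow_succ]
    field_simp
    ring
  · rw [hyperCoeff_self, hyperCoeff_self, hyperCoeff_eq_zero _ _ _ _ (Nat.lt_succ_self i)]
    ring
  · rw [hyperCoeff_eq_zero _ _ _ _ h, hyperCoeff_eq_zero _ _ _ _ (Nat.succ_lt_succ h),
      hyperCoeff_eq_zero _ _ _ _ (by omega)]
    ring

/-- Multiplication by `x`: the constant coefficient. -/
theorem hyperCoeff_raise_zero (a b : ℝ) {e f : ℝ} (he : 0 < e) (hf : 0 < f) (n : ℕ) :
    hyperCoeff a b (e + 1) f (n + 1) 0 +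
      (a + n) * (b + n) * e / ((e + n) * (e + n + 1) * (f + n)) * hyperCoeff a b e f n 0 = 0 := by
  have hE' := hgPoch_succ e n
  rw [hgPoch_succ_left] at hE'
  simp only [hyperCoeff, Nat.sub_zero, Nat.cast_zero, add_zero, Nat.choose_zero_right, hgPoch_succ]
  have hE := hgPoch_pos (x := e + 1) (by positivity) n
  have hE0 := hgPoch_pos he n
  have hF := hgPoch_pos hf n
  generalize hgPoch (e + 1) n = E at *
  generalize hgPoch e n = E' at *
  have hE2 : E = E' * (e + n) / e := by
    rw [← hE']
    field_simp
  rw [hE2]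
  have h1 : e + n ≠ 0 := by positivity
  have h2 : e + 1 + n ≠ 0 := by positivity
  have h3 : e + n + 1 ≠ 0 := by positivity
  have h4 : f + n ≠ 0 := by positivity
  rw [pow_succ]
  push_cast
  field_simp
  ring

/-! ## The hypergeometric Jacobi matrix -/

/-- The sequence `c_{n-1}`, that is `c, d, c + 1, d + 1, …`. -/
noncomputable def hgS (c d : ℝ) (n : ℕ) : ℝ :=
  (if Even n then c else d) + (n / 2 : ℕ)

theorem hgS_zero (c d : ℝ) : hgS c d 0 = c := by simp [hgS]

theorem hgS_one (c d : ℝ) : hgS c d 1 = d := by simp [hgS]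

theorem hgS_add_two (c d : ℝ) (n : ℕ) : hgS c d (n + 2) = hgS c d n + 1 := by
  have h : (n + 2) / 2 = n / 2 + 1 := by omega
  simp only [hgS, h, Nat.even_add, even_two, iff_true]
  push_cast
  ring

theorem hgC_eq (c d : ℝ) (n : ℕ) : hgC c d n = hgS c d (n + 1) := by
  unfold hgC hgS
  rcases Nat.even_or_odd n with h | h
  · have h2 : (n + 1) / 2 = n / 2 := by
      obtain ⟨k, rfl⟩ := h
      omega
    rw [if_pos h, if_neg (by simpa [Nat.even_add_one] using h), h2]
  · rw [if_neg (Nat.not_even_iff_odd.2 h), if_pos h.add_one]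

theorem hgS_pos {c d : ℝ} (hc : 0 < c) (hd : 0 < d) (n : ℕ) : 0 < hgS c d n := by
  unfold hgS
  split_ifs <;> positivity

section Lambda

variable (a b c d : ℝ)

theorem hgLambda_zero : hgLambda a b c d 0 = 0 := by simp [hgLambda]

theorem hgLambda_one : hgLambda a b c d 1 = 0 := by simp [hgLambda]

theorem hgLambda_two : hgLambda a b c d 2 = a * b / (c * d) := by simp [hgLambda]

theorem hgLambda_three_mul_add_three (n : ℕ) : hgLambda a b c d (3 * n + 3) =
    (n + 1) * (b + n) * (hgS c d n - a) /
      ((hgS c d n + n) * (hgS c d n + n + 1) * (hgS c d (n + 1) + n)) := by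
  have h1 : (3 * n + 3) / 3 = n + 1 := by omega
  have h2 : (3 * n + 3) % 3 = 0 := by omega
  simp only [hgLambda, h1, h2, hgC_eq, Nat.add_sub_cancel, hgS_add_two, Nat.succ_ne_zero, if_false,
    if_true, show n + 1 + 1 = n + 2 from rfl]
  push_cast
  congr 1 <;> ring

theorem hgLambda_three_mul_add_four (n : ℕ) : hgLambda a b c d (3 * n + 4) =
    (n + 1) * (a + 1 + n) * (hgS c d (n + 1) - b) /
      ((hgS c d (n + 1) + n) * (hgS c d (n + 1) + n + 1) * (hgS c d (n + 2) + n)) := by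
  have h1 : (3 * n + 4) / 3 = n + 1 := by omega
  have h2 : (3 * n + 4) % 3 = 1 := by omega
  simp only [hgLambda, h1, h2, hgC_eq, Nat.add_sub_cancel, hgS_add_two, Nat.succ_ne_zero, if_false,
    if_true, one_ne_zero, show n + 1 + 1 = n + 2 from rfl]
  push_cast
  congr 1 <;> ring

theorem hgLambda_three_mul_add_five (n : ℕ) : hgLambda a b c d (3 * n + 5) =
    (a + (n + 1 : ℕ)) * (b + (n + 1 : ℕ)) * hgS c d n /
      ((hgS c d n + (n + 1 : ℕ)) * (hgS c d n + (n + 1 : ℕ) + 1) *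
        (hgS c d (n + 1) + (n + 1 : ℕ))) := by
  have h1 : (3 * n + 5) / 3 = n + 1 := by omega
  have h2 : (3 * n + 5) % 3 = 2 := by omega
  simp only [hgLambda, h1, h2, hgC_eq, Nat.add_sub_cancel, hgS_add_two, Nat.succ_ne_zero, if_false,
    show (2 : ℕ) ≠ 1 by norm_num, show (2 : ℕ) ≠ 0 by norm_num, show n + 1 + 1 = n + 2 from rfl]
  push_cast
  congr 1 <;> ring

end Lambda

/-- The coefficients of the type II polynomials. -/
noncomputable def hgTypeII (a b c d : ℝ) : Matrix ℕ ℕ ℝ :=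
  Matrix.of fun n i => hyperCoeff a b (hgS c d n) (hgS c d (n + 1) - 1) n i

/-- The natural denominator parameters in degree n are `hgS n` and `hgS (n - 1)`. The definition
writes the latter as `hgS (n + 1) - 1` to make sense at n = 0, where the only nonzero coefficient is
1 and the parameters do not matter. -/
theorem hgTypeII_succ (a b c d : ℝ) (n i : ℕ) : hgTypeII a b c d (n + 1) i =
    hyperCoeff a b (hgS c d n) (hgS c d (n + 1)) (n + 1) i := by
  rw [hgTypeII, Matrix.of_apply, hgS_add_two, add_sub_cancel_right, hyperCoeff_symm_denom]

theorem isLowerUnitriangular_hgTypeII (a b c d : ℝ) :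
    IsLowerUnitriangular (hgTypeII a b c d) :=
  ⟨fun _ => hyperCoeff_self _ _ _ _ _, fun _ _ h => hyperCoeff_eq_zero _ _ _ _ h⟩

/-- The tetradiagonal matrix with entries `1`, `β`, `α`, `γ`. -/
noncomputable def hgJacobi (a b c d : ℝ) : Matrix ℕ ℕ ℝ := Matrix.of fun n m =>
  if m = n + 1 then 1 else if m = n then hgBeta a b c d n else
  if m + 1 = n then hgAlphaSucc a b c d m else if m + 2 = n then hgGammaSucc a b c d m else 0

section Jacobi

variable (a b c d : ℝ)

theorem hgJacobi_succ (n : ℕ) : hgJacobi a b c d n (n + 1) = 1 := by simp [hgJacobi]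

theorem hgJacobi_self (n : ℕ) : hgJacobi a b c d n n = hgBeta a b c d n := by simp [hgJacobi]

theorem hgJacobi_add_one (n : ℕ) : hgJacobi a b c d (n + 1) n = hgAlphaSucc a b c d n := by
  simp [hgJacobi, show n ≠ n + 1 + 1 by omega]

theorem hgJacobi_add_two (n : ℕ) : hgJacobi a b c d (n + 2) n = hgGammaSucc a b c d n := by
  simp [hgJacobi, show n ≠ n + 2 + 1 by omega]

theorem hgJacobi_eq_zero {n m : ℕ} (h : n + 1 < m ∨ m + 2 < n) : hgJacobi a b c d n m = 0 := by
  simp only [hgJacobi, Matrix.of_apply]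
  rw [if_neg (by omega), if_neg (by omega), if_neg (by omega), if_neg (by omega)]

theorem rowFinite_hgJacobi : RowFinite (hgJacobi a b c d) :=
  rowFinite_of_eq_zero (· + 1) fun _ _ h => hgJacobi_eq_zero a b c d (Or.inl h)

theorem sum_hgJacobi_row (f : ℕ → ℝ) (n : ℕ) :
    ∑ k ∈ Finset.range (n + 2), hgJacobi a b c d n k * f k =
      f (n + 1) + hgBeta a b c d n * f n +
        (if 1 ≤ n then hgAlphaSucc a b c d (n - 1) * f (n - 1) else 0) +
        (if 2 ≤ n then hgGammaSucc a b c d (n - 2) * f (n - 2) else 0) := by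
  rw [Finset.sum_range_succ, Finset.sum_range_succ, hgJacobi_succ, hgJacobi_self]
  rcases n with _ | _ | n
  · simp [add_comm]
  · simp [hgJacobi_add_one]
    ring
  · rw [Finset.sum_range_succ, Finset.sum_range_succ, hgJacobi_add_one, hgJacobi_add_two,
      Finset.sum_eq_zero fun k hk => by
        rw [hgJacobi_eq_zero a b c d (Or.inr (by have := Finset.mem_range.1 hk; omega)), zero_mul]]
    simp
    ring

theorem sum_hgJacobi_column (f : ℕ → ℝ) (n : ℕ) :
    ∑ k ∈ Finset.range (n + 3), hgJacobi a b c d k n * f k =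
      (if 1 ≤ n then f (n - 1) else 0) + hgBeta a b c d n * f n +
        hgAlphaSucc a b c d n * f (n + 1) + hgGammaSucc a b c d n * f (n + 2) := by
  rw [Finset.sum_range_succ, Finset.sum_range_succ, Finset.sum_range_succ, hgJacobi_self,
    hgJacobi_add_one, hgJacobi_add_two]
  rcases n with _ | n
  · simp
  · rw [Finset.sum_range_succ, hgJacobi_succ, Finset.sum_eq_zero fun k hk => by
        rw [hgJacobi_eq_zero a b c d (Or.inl (by have := Finset.mem_range.1 hk; omega)), zero_mul]]
    simp

variable {a b c d}

/-- The three contiguity relations behind the recurrence: `B_n` is a lower bidiagonal combination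
of polynomials `Q_n`, these are one of polynomials `R_n`, and `x R_n = B_{n+1} + λ_{3n+2} B_n`. -/
theorem hgTypeII_factorization (hc : 0 < c) (hd : 0 < d) : ∃ Q R : ℕ → ℕ → ℝ,
    (∀ i, hgTypeII a b c d 0 i = Q 0 i) ∧ (∀ i, Q 0 i = R 0 i) ∧
    (∀ n i, hgTypeII a b c d (n + 1) i = Q (n + 1) i + hgLambda a b c d (3 * n + 3) * Q n i) ∧
    (∀ n i, Q (n + 1) i = R (n + 1) i + hgLambda a b c d (3 * n + 4) * R n i) ∧
    (∀ n i, R n i = hgTypeII a b c d (n + 1) (i + 1) +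
      hgLambda a b c d (3 * n + 2) * hgTypeII a b c d n (i + 1)) ∧
    ∀ n, hgTypeII a b c d (n + 1) 0 + hgLambda a b c d (3 * n + 2) * hgTypeII a b c d n 0 = 0 := by
  have hs := hgS_pos hc hd
  have h0 : ∀ x y z w x' y' z' w' : ℝ, ∀ i,
      hyperCoeff x y z w 0 i = hyperCoeff x' y' z' w' 0 i := by
    rintro x y z w x' y' z' w' (_ | i)
    · rw [hyperCoeff_self, hyperCoeff_self]
    · rw [hyperCoeff_eq_zero _ _ _ _ i.succ_pos, hyperCoeff_eq_zero _ _ _ _ i.succ_pos]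
  refine ⟨fun n i => hyperCoeff (a + 1) b (hgS c d (n + 1)) (hgS c d n) n i,
    fun n i => hyperCoeff (a + 1) (b + 1) (hgS c d (n + 1)) (hgS c d n + 1) n i,
    h0 _ _ _ _ _ _ _ _, h0 _ _ _ _ _ _ _ _, fun n i => ?_, fun n i => ?_, fun n i => ?_,
    fun n => ?_⟩
  · rw [hgTypeII_succ, hyperCoeff_shift a b (hs n) (hs (n + 1)), hgLambda_three_mul_add_three]
    dsimp only
    rw [hgS_add_two, hyperCoeff_symm_denom (a + 1) b (hgS c d n + 1)]
  · have h := hyperCoeff_shift b (a + 1) (hs (n + 1)) (hs (n + 2)) n i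
    rw [hyperCoeff_symm_num b, hyperCoeff_symm_num (b + 1), hyperCoeff_symm_num (b + 1),
      hyperCoeff_symm_denom _ _ (hgS c d (n + 1)), hyperCoeff_symm_denom _ _ (hgS c d (n + 1) + 1),
      hyperCoeff_symm_denom _ _ (hgS c d (n + 2)) (hgS c d (n + 1)) n] at h
    dsimp only
    rw [hgLambda_three_mul_add_four, ← hgS_add_two c d n]
    exact h
  -- The general formula for λ_{3n+2} contains the cancelled factor d - 1 at n = 0, so λ₂ is treated
  -- separately.
  · rcases n with _ | n
    · rw [hgTypeII_succ, hgS_zero, hgS_one, hgLambda_two, hgTypeII, Matrix.of_apply,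
        hyperCoeff_eq_zero _ _ _ _ i.succ_pos, mul_zero, add_zero]
      dsimp only
      rcases i with _ | i
      · rw [hyperCoeff_self, hyperCoeff_self]
      · rw [hyperCoeff_eq_zero _ _ _ _ i.succ_pos, hyperCoeff_eq_zero _ _ _ _ (by omega)]
    · have h := hyperCoeff_raise a b (hs n) (hs (n + 1)) (n + 1) i
      rw [← hgS_add_two] at h
      rw [hgTypeII_succ, hgTypeII_succ, show 3 * (n + 1) + 2 = 3 * n + 5 by ring,
        hgLambda_three_mul_add_five, hyperCoeff_symm_denom a b (hgS c d (n + 1))]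
      exact h
  · rcases n with _ | n
    · rw [hgTypeII_succ, hgS_zero, hgS_one, hgLambda_two, hgTypeII, Matrix.of_apply,
        hyperCoeff_self]
      simp [hyperCoeff, hgPoch]
    · have h := hyperCoeff_raise_zero a b (hs n) (hs (n + 1)) (n + 1)
      rw [← hgS_add_two] at h
      rw [hgTypeII_succ, hgTypeII_succ, show 3 * (n + 1) + 2 = 3 * n + 5 by ring,
        hgLambda_three_mul_add_five, hyperCoeff_symm_denom a b (hgS c d (n + 1))]
      exact h

theorem hgJacobi_semiMul_hgTypeII (hc : 0 < c) (hd : 0 < d) :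
    semiMul (hgJacobi a b c d) (hgTypeII a b c d) = semiMul (hgTypeII a b c d) shiftMatrix := by
  obtain ⟨Q, R, hB0, hQ0, hB, hQ, hR, hR0⟩ := hgTypeII_factorization (a := a) (b := b) hc hd
  ext n i
  rw [semiMul_eq_sum _ _ i (Finset.range (n + 2)) fun k hk =>
    hgJacobi_eq_zero a b c d (Or.inl (by simpa [Nat.succ_le_iff] using hk)),
    sum_hgJacobi_row a b c d fun k => hgTypeII a b c d k i]
  have hright : semiMul (hgTypeII a b c d) shiftMatrix n i =
      if i = 0 then 0 else hgTypeII a b c d n (i - 1) := by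
    rw [semiMul, Matrix.of_apply]
    rcases i with _ | i
    · simp [shiftMatrix]
    · rw [finsum_eq_single _ i fun k hk => by simp [shiftMatrix, hk.symm]]
      simp [shiftMatrix]
  rw [hright]
  have e0 : hgLambda a b c d 0 = 0 := hgLambda_zero a b c d
  have e1 : hgLambda a b c d 1 = 0 := hgLambda_one a b c d
  -- `r n` is the coefficient of x^i in x R_n. It vanishes for i = 0, so both cases have the common
  -- form r = UB, xB = L₁L₂ r. Rows 0 and 1 of L₁L₂ are shorter than the others.
  have hi : ∃ r : ℕ → ℝ, (∀ n, r n = hgTypeII a b c d (n + 1) i +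
      hgLambda a b c d (3 * n + 2) * hgTypeII a b c d n i) ∧
      (if i = 0 then 0 else hgTypeII a b c d 0 (i - 1)) = r 0 ∧
      (if i = 0 then 0 else hgTypeII a b c d 1 (i - 1)) =
        r 1 + (hgLambda a b c d 3 + hgLambda a b c d 4) * r 0 ∧
      ∀ n, (if i = 0 then 0 else hgTypeII a b c d (n + 2) (i - 1)) =
        r (n + 2) + (hgLambda a b c d (3 * n + 6) + hgLambda a b c d (3 * n + 7)) * r (n + 1) +
          hgLambda a b c d (3 * n + 6) * hgLambda a b c d (3 * n + 4) * r n := by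
    rcases i with _ | i
    · exact ⟨fun _ => 0, fun n => (hR0 n).symm, by simp, by simp, by simp⟩
    · refine ⟨fun n => R n i, fun n => hR n i, ?_, ?_, fun n => ?_⟩
      · simp [hB0, hQ0]
      · have h1 := hB 0 i
        have h2 := hQ 0 i
        simp only [mul_zero, zero_add] at h1 h2
        simp only [Nat.succ_ne_zero, if_false, Nat.add_sub_cancel, h1, h2, hQ0]
        ring
      · have h1 := hB (n + 1) i
        have h2 := hQ (n + 1) i
        rw [show 3 * (n + 1) + 3 = 3 * n + 6 by ring] at h1
        rw [show 3 * (n + 1) + 4 = 3 * n + 7 by ring] at h2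
        simp only [Nat.succ_ne_zero, if_false, Nat.add_sub_cancel, h1, h2, hQ n]
        ring
  obtain ⟨r, hr, hz, ho, ht⟩ := hi
  rcases n with _ | _ | n
  · rw [hz, hr]
    simp [hgBeta, e0, e1]
  · rw [zero_add, ho, hr, hr]
    simp [hgBeta, hgAlphaSucc, e1]
    ring
  · rw [show n + 1 + 1 = n + 2 from rfl, ht, hr, hr, hr]
    simp only [hgBeta, hgAlphaSucc, hgGammaSucc, show 1 ≤ n + 2 by omega, show 2 ≤ n + 2 by omega,
      if_true, Nat.add_sub_cancel, show n + 2 - 1 = n + 1 by omega, show 3 * (n + 2) = 3 * n + 6 by ring,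
      show 3 * (n + 1) = 3 * n + 3 by ring, add_assoc, Nat.reduceAdd]
    ring

theorem hgS_sub_nonneg (hda : a ≤ d) (hca : a ≤ c) (n : ℕ) : 0 ≤ hgS c d n - a := by
  unfold hgS
  have : (0 : ℝ) ≤ (n / 2 : ℕ) := Nat.cast_nonneg _
  split_ifs <;> linarith

/-- Omitting index 0 leaves d, c + 1, d + 1, …, so only d and c + 1 have to exceed b. It is also
used with a in place of b, where a = c remains possible. -/
theorem hgS_succ_sub_pos (hdb : b < d) (hcb : b < c + 1) (n : ℕ) : 0 < hgS c d (n + 1) - b := by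
  unfold hgS
  have : (0 : ℝ) ≤ ((n + 1) / 2 : ℕ) := Nat.cast_nonneg _
  split_ifs with h
  · have h2 : (n + 1) / 2 = (n - 1) / 2 + 1 := by
      obtain ⟨k, hk⟩ := h
      omega
    have : (0 : ℝ) ≤ ((n - 1) / 2 : ℕ) := Nat.cast_nonneg _
    rw [h2]
    push_cast
    linarith
  · linarith

end Jacobi

/-! ## Orthogonality -/

/-- The sum is the N-th forward difference of P at 0. -/
theorem sum_alternating_choose_mul_eval_eq_zero {P : ℝ[X]} {N : ℕ} (hP : P.natDegree < N) :
    ∑ i ∈ Finset.range (N + 1), (-1) ^ (N - i) * (N.choose i : ℝ) * P.eval (i : ℝ) = 0 := by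
  have h := congrFun (Polynomial.fwdDiff_iter_eq_zero_of_degree_lt hP) 0
  rw [fwdDiff_iter_eq_sum_shift] at h
  simpa using h

/-- The moments `(a)_n (b)_n / ((c)_n (d)_n)`. -/
noncomputable def pochMoment (a b c d : ℝ) (n : ℕ) : ℝ :=
  hgPoch a n * hgPoch b n / (hgPoch c n * hgPoch d n)

/-- The numerators combine to (a)_N (b)_N, while (c)_{i+p} = (c)_p (c+p)_i = (c)_i (c+i)_p moves the
denominators into a polynomial in i. Up to a constant the product is a signed binomial times a
polynomial of degree p + r, ready for a finite difference of order N. -/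
theorem hyperCoeff_mul_pochMoment (a b : ℝ) {c d : ℝ} (hc : 0 < c) (hd : 0 < d) (p r : ℕ) {N i : ℕ} (hi : i ≤ N) :
    hyperCoeff a b (c + p) (d + r) N i * pochMoment a b c d i =
      hgPoch a N * hgPoch b N / (hgPoch (c + p) N * hgPoch (d + r) N * hgPoch c p * hgPoch d r) *
        ((-1) ^ (N - i) * (N.choose i : ℝ) * (hgPoch (c + i) p * hgPoch (d + i) r)) := by
  obtain ⟨k, rfl⟩ := Nat.exists_eq_add_of_le hi
  have hcp : 0 < c + p := by positivity
  have hdr : 0 < d + r := by positivity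
  have hci : 0 < c + p + i := by positivity
  have hdi : 0 < d + r + i := by positivity
  have e1 := hgPoch_add c p i
  rw [add_comm p i, hgPoch_add] at e1
  have e2 := hgPoch_add d r i
  rw [add_comm r i, hgPoch_add] at e2
  have e1' : hgPoch (c + i) p = hgPoch c p * hgPoch (c + p) i / hgPoch c i := by
    rw [← e1, mul_div_cancel_left₀ _ (hgPoch_pos hc i).ne']
  have e2' : hgPoch (d + i) r = hgPoch d r * hgPoch (d + r) i / hgPoch d i := by
    rw [← e2, mul_div_cancel_left₀ _ (hgPoch_pos hd i).ne']
  rw [e1', e2', hyperCoeff, pochMoment, Nat.add_sub_cancel_left, hgPoch_add a, hgPoch_add b,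
    hgPoch_add (c + p), hgPoch_add (d + r)]
  have h1 := (hgPoch_pos hc i).ne'
  have h2 := (hgPoch_pos hd i).ne'
  have h3 := (hgPoch_pos hc p).ne'
  have h4 := (hgPoch_pos hd r).ne'
  have h5 := (hgPoch_pos hcp i).ne'
  have h6 := (hgPoch_pos hdr i).ne'
  have h7 := (hgPoch_pos hci k).ne'
  have h8 := (hgPoch_pos hdi k).ne'
  field_simp

theorem natDegree_comp_ascPochhammer_le (x : ℝ) (p : ℕ) :
    ((ascPochhammer ℝ p).comp (X + C x)).natDegree ≤ p := by
  rw [natDegree_comp, ascPochhammer_natDegree, natDegree_X_add_C, mul_one]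

theorem eval_comp_ascPochhammer (x y : ℝ) (p : ℕ) :
    ((ascPochhammer ℝ p).comp (X + C x)).eval y = hgPoch (x + y) p := by
  simp [hgPoch, add_comm]

theorem sum_hyperCoeff_mul_pochMoment (a b : ℝ) {c d : ℝ} (hc : 0 < c) (hd : 0 < d) (p r : ℕ) :
    ∑ i ∈ Finset.range (p + r + 1 + 1), hyperCoeff a b (c + p) (d + r) (p + r + 1) i *
      pochMoment a b c d i = 0 := by
  have h := sum_alternating_choose_mul_eval_eq_zero (N := p + r + 1)
    (P := (ascPochhammer ℝ p).comp (X + C c) * (ascPochhammer ℝ r).comp (X + C d))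
    (Nat.lt_succ_of_le (natDegree_mul_le.trans
      (add_le_add (natDegree_comp_ascPochhammer_le c p) (natDegree_comp_ascPochhammer_le d r))))
  simp only [eval_mul, eval_comp_ascPochhammer] at h
  rw [Finset.sum_congr rfl fun i hi => hyperCoeff_mul_pochMoment a b hc hd p r
    (Finset.mem_range_succ_iff.1 hi), ← Finset.mul_sum, h, mul_zero]

theorem pochMoment_shift {a b c d : ℝ} (hb : 0 < b) (hc : 0 < c) (n : ℕ) :
    pochMoment a (b + 1) (c + 1) d n = pochMoment a b c d n * (c * (b + n) / (b * (c + n))) := by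
  have e1 := hgPoch_succ b n
  have e2 := hgPoch_succ c n
  rw [hgPoch_succ_left] at e1 e2
  have h1 := hgPoch_pos hc n
  have h2 := hgPoch_pos (x := c + 1) (by positivity) n
  have h3 : c + n ≠ 0 := by positivity
  have e1' : hgPoch (b + 1) n = hgPoch b n * (b + n) / b := by
    rw [← e1]
    field_simp
  have e2' : hgPoch (c + 1) n = hgPoch c n * (c + n) / c := by
    rw [← e2]
    field_simp
  rw [pochMoment, pochMoment, e1', e2']
  field_simp

/-- Passing to the second weight multiplies the i-th moment by a multiple of (b+i)/(c+i). The
denominator cancels the first factor of (c+i)_{p+1}, so a polynomial of unchanged degree remains;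
this requires at least one shift of c. -/
theorem sum_hyperCoeff_mul_pochMoment_shift (a : ℝ) {b c d : ℝ} (hb : 0 < b) (hc : 0 < c)
    (hd : 0 < d) (p r : ℕ) :
    ∑ i ∈ Finset.range (p + 1 + r + 1 + 1),
      hyperCoeff a b (c + (p + 1 : ℕ)) (d + r) (p + 1 + r + 1) i *
        pochMoment a (b + 1) (c + 1) d i = 0 := by
  have h := sum_alternating_choose_mul_eval_eq_zero (N := p + 1 + r + 1)
    (P := (X + C b) * ((ascPochhammer ℝ p).comp (X + C (c + 1)) *
      (ascPochhammer ℝ r).comp (X + C d)))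
    (Nat.lt_succ_of_le (by
      have h1 := natDegree_mul_le (p := (X + C b)) (q := (ascPochhammer ℝ p).comp (X + C (c + 1)) *
        (ascPochhammer ℝ r).comp (X + C d))
      have h2 := natDegree_mul_le (p := (ascPochhammer ℝ p).comp (X + C (c + 1)))
        (q := (ascPochhammer ℝ r).comp (X + C d))
      have h3 := natDegree_comp_ascPochhammer_le (c + 1) p
      have h4 := natDegree_comp_ascPochhammer_le d r
      rw [natDegree_X_add_C] at h1
      omega))
  simp only [eval_mul, eval_comp_ascPochhammer, eval_add, eval_X, eval_C] at h
  -- The constant collects those of `pochMoment_shift` and `hyperCoeff_mul_pochMoment`.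
  rw [← mul_zero (c / b * (hgPoch a (p + 1 + r + 1) * hgPoch b (p + 1 + r + 1) /
    (hgPoch (c + (p + 1 : ℕ)) (p + 1 + r + 1) * hgPoch (d + r) (p + 1 + r + 1) *
      hgPoch c (p + 1) * hgPoch d r))), ← h, Finset.mul_sum]
  refine Finset.sum_congr rfl fun i hi => ?_
  rw [pochMoment_shift hb hc, ← mul_assoc, hyperCoeff_mul_pochMoment a b hc hd (p + 1) r
    (Finset.mem_range_succ_iff.1 hi), hgPoch_succ_left (c + i) p, add_right_comm c]
  have h3 : c + i ≠ 0 := by positivity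
  field_simp
  ring

theorem hgS_eq_add (c d : ℝ) (n : ℕ) :
    (hgS c d n = c + ((n + 1) / 2 : ℕ) ∧ hgS c d (n + 1) = d + (n / 2 : ℕ)) ∨
      (hgS c d n = d + (n / 2 : ℕ) ∧ hgS c d (n + 1) = c + ((n + 1) / 2 : ℕ)) := by
  unfold hgS
  rcases Nat.even_or_odd n with h | h
  · left
    have h2 : (n + 1) / 2 = n / 2 := by
      obtain ⟨k, rfl⟩ := h
      omega
    rw [if_pos h, if_neg (by simpa [Nat.even_add_one] using h), h2]
    exact ⟨rfl, rfl⟩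
  · right
    rw [if_neg (Nat.not_even_iff_odd.2 h), if_pos h.add_one]
    exact ⟨rfl, rfl⟩

/-- Symmetry in the denominator parameters puts the one built on c first. The shifts ⌈n/2⌉ of c and
⌊n/2⌋ of d add up to n, one less than the degree, as the finite difference argument requires. -/
theorem hgTypeII_succ_eq (a b c d : ℝ) (n i : ℕ) : hgTypeII a b c d (n + 1) i =
    hyperCoeff a b (c + ((n + 1) / 2 : ℕ)) (d + (n / 2 : ℕ)) (n + 1) i := by
  rw [hgTypeII_succ]
  rcases hgS_eq_add c d n with ⟨h1, h2⟩ | ⟨h1, h2⟩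
  · rw [h1, h2]
  · rw [h1, h2, hyperCoeff_symm_denom]

/-! ### Signs of the coefficients λ -/

theorem hgLambda_pos_two {a b c d : ℝ} (ha : 0 < a) (hb : 0 < b) (hc : 0 < c) (hd : 0 < d)
    (n : ℕ) : 0 < hgLambda a b c d (3 * n + 2) := by
  rcases n with _ | n
  · rw [hgLambda_two]
    positivity
  · have h1 := hgS_pos hc hd n
    have h2 := hgS_pos hc hd (n + 1)
    rw [show 3 * (n + 1) + 2 = 3 * n + 5 by ring, hgLambda_three_mul_add_five]
    positivity

theorem hgLambda_nonneg_three {a b c d : ℝ} (hb : 0 < b) (hc : 0 < c) (hd : 0 < d) (hda : a ≤ d)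
    (hca : a ≤ c) (n : ℕ) : 0 ≤ hgLambda a b c d (3 * n + 3) := by
  have h1 := hgS_pos hc hd n
  have h2 := hgS_pos hc hd (n + 1)
  have h3 := hgS_sub_nonneg hda hca n
  rw [hgLambda_three_mul_add_three]
  positivity

/-- λ₃ has the factor c - a and may vanish, but γ involves only λ₆, λ₉, …, which stay positive when
a = c. -/
theorem hgLambda_pos_six {a b c d : ℝ} (hb : 0 < b) (hc : 0 < c) (hd : 0 < d) (hda : a < d)
    (hca : a < c + 1) (n : ℕ) : 0 < hgLambda a b c d (3 * n + 6) := by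
  have h1 := hgS_pos hc hd (n + 1)
  have h2 := hgS_pos hc hd (n + 2)
  have h3 := hgS_succ_sub_pos hda hca n
  rw [show 3 * n + 6 = 3 * (n + 1) + 3 by ring, hgLambda_three_mul_add_three]
  positivity

theorem hgLambda_pos_four {a b c d : ℝ} (ha : 0 < a) (hc : 0 < c) (hd : 0 < d) (hdb : b < d)
    (hcb : b < c + 1) (n : ℕ) : 0 < hgLambda a b c d (3 * n + 4) := by
  have h1 := hgS_pos hc hd (n + 1)
  have h2 := hgS_pos hc hd (n + 2)
  have h3 := hgS_succ_sub_pos hdb hcb n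
  rw [hgLambda_three_mul_add_four]
  positivity

section Hypergeometric

variable {a b c d : ℝ}

theorem hgGammaSucc_pos (ha : 0 < a) (hb : 0 < b) (hc : 0 < c) (hd : 0 < d) (hda : a < d)
    (hca : a < c + 1) (hdb : b < d) (hcb : b < c + 1) (n : ℕ) : 0 < hgGammaSucc a b c d n :=
  mul_pos (mul_pos (hgLambda_pos_two ha hb hc hd n) (hgLambda_pos_four ha hc hd hdb hcb n))
    (hgLambda_pos_six hb hc hd hda hca n)

theorem hgLambda_nonneg (ha : 0 < a) (hb : 0 < b) (hc : 0 < c) (hd : 0 < d) (hda : a < d)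
    (hca : a ≤ c) (hdb : b < d) (hcb : b < c + 1) (m : ℕ) : 0 ≤ hgLambda a b c d m := by
  have hm : m = 0 ∨ m = 1 ∨ (∃ n, m = 3 * n + 2) ∨ (∃ n, m = 3 * n + 3) ∨ ∃ n, m = 3 * n + 4 := by
    have h : m = 0 ∨ m = 1 ∨ m = 3 * (m / 3) + 2 ∨ m = 3 * (m / 3 - 1) + 3 ∨
      m = 3 * (m / 3 - 1) + 4 := by omega
    rcases h with h | h | h | h | h
    exacts [.inl h, .inr (.inl h), .inr (.inr (.inl ⟨_, h⟩)), .inr (.inr (.inr (.inl ⟨_, h⟩))),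
      .inr (.inr (.inr (.inr ⟨_, h⟩)))]
  rcases hm with rfl | rfl | ⟨n, rfl⟩ | ⟨n, rfl⟩ | ⟨n, rfl⟩
  · exact (hgLambda_zero _ _ _ _).ge
  · exact (hgLambda_one _ _ _ _).ge
  · exact (hgLambda_pos_two ha hb hc hd n).le
  · exact hgLambda_nonneg_three hb hc hd hda.le hca n
  · exact (hgLambda_pos_four ha hc hd hdb hcb n).le

theorem hgJacobi_nonneg (h : ∀ m, 0 ≤ hgLambda a b c d m) (n m : ℕ) :
    0 ≤ hgJacobi a b c d n m := by
  have hβ : 0 ≤ hgBeta a b c d n := add_nonneg (add_nonneg (h _) (h _)) (h _)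
  have hα : 0 ≤ hgAlphaSucc a b c d m :=
    add_nonneg (mul_nonneg (add_nonneg (h _) (h _)) (h _)) (mul_nonneg (h _) (h _))
  have hγ : 0 ≤ hgGammaSucc a b c d m := mul_nonneg (mul_nonneg (h _) (h _)) (h _)
  simp only [hgJacobi, Matrix.of_apply]
  split_ifs
  exacts [zero_le_one, hβ, hα, hγ, le_rfl]

/-! ### Triangularity of S g and existence of the factorization -/

variable {g : Matrix ℕ ℕ ℝ}

theorem semiMul_hgTypeII_zero (hc : 0 < c) (hd : 0 < d)
    (h0 : ∀ n, g n 0 = pochMoment a b c d n) (n : ℕ) :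
    semiMul (hgTypeII a b c d) g (n + 1) 0 = 0 := by
  rw [(isLowerUnitriangular_hgTypeII a b c d).semiMul_eq_sum]
  have h := sum_hyperCoeff_mul_pochMoment a b hc hd ((n + 1) / 2) (n / 2)
  rw [show (n + 1) / 2 + n / 2 + 1 = n + 1 by omega] at h
  simpa only [hgTypeII_succ_eq, h0] using h

theorem semiMul_hgTypeII_one (hb : 0 < b) (hc : 0 < c) (hd : 0 < d)
    (h1 : ∀ n, g n 1 = pochMoment a (b + 1) (c + 1) d n) (n : ℕ) :
    semiMul (hgTypeII a b c d) g (n + 2) 1 = 0 := by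
  rw [(isLowerUnitriangular_hgTypeII a b c d).semiMul_eq_sum]
  have h := sum_hyperCoeff_mul_pochMoment_shift a hb hc hd (n / 2) ((n + 1) / 2)
  rw [show n / 2 + 1 + (n + 1) / 2 + 1 = n + 2 by omega,
    show n / 2 + 1 = (n + 1 + 1) / 2 by omega] at h
  simpa only [hgTypeII_succ_eq, h1] using h

theorem semiMul_hgTypeII_zero_zero (h0 : ∀ n, g n 0 = pochMoment a b c d n) :
    semiMul (hgTypeII a b c d) g 0 0 = 1 := by
  rw [(isLowerUnitriangular_hgTypeII a b c d).semiMul_eq_sum]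
  simp [h0, pochMoment, hgPoch_zero, (isLowerUnitriangular_hgTypeII a b c d).1]

theorem semiMul_hgTypeII_one_one (hc : 0 < c) (hd : 0 < d)
    (h1 : ∀ n, g n 1 = pochMoment a (b + 1) (c + 1) d n) :
    semiMul (hgTypeII a b c d) g 1 1 = a * (c - b) / (d * c * (c + 1)) := by
  rw [(isLowerUnitriangular_hgTypeII a b c d).semiMul_eq_sum, Finset.sum_range_succ,
    Finset.sum_range_one, (isLowerUnitriangular_hgTypeII a b c d).1, hgTypeII_succ_eq, h1, h1]
  simp [pochMoment, hgPoch, hyperCoeff]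
  field_simp
  ring

/-- S g (Λᵀ)² = S Λ g = T S g with the tetradiagonal T, so two columns of S g determine all others.
-/
theorem semiMul_hgTypeII_shift (hc : 0 < c) (hd : 0 < d)
    (hg : ∀ n m, g (n + 1) m = g n (m + 2)) (n m : ℕ) :
    semiMul (hgTypeII a b c d) g n (m + 2) = ∑ k ∈ Finset.range (n + 2), hgJacobi a b c d n k *
      semiMul (hgTypeII a b c d) g k m := by
  have hS := isLowerUnitriangular_hgTypeII a b c d
  rw [← semiMul_eq_sum _ _ _ _ fun k hk =>
      hgJacobi_eq_zero a b c d (Or.inl (by simpa [Nat.succ_le_iff] using hk)),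
    ← semiMul_assoc (rowFinite_hgJacobi a b c d) hS.rowFinite, hgJacobi_semiMul_hgTypeII hc hd,
    semiMul_assoc hS.rowFinite rowFinite_shiftMatrix, hS.semiMul_eq_sum, hS.semiMul_eq_sum]
  exact Finset.sum_congr rfl fun k _ => by rw [semiMul_shiftMatrix_left, hg]

/-- The Gauss--Borel factorization of a matrix with hypergeometric moments. -/
theorem exists_gaussBorel_of_moments (ha : 0 < a) (hb : 0 < b) (hc : 0 < c) (hd : 0 < d)
    (hcb : c ≠ b) (hγ : ∀ n, 0 < hgGammaSucc a b c d n)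
    (h0 : ∀ n, g n 0 = pochMoment a b c d n)
    (h1 : ∀ n, g n 1 = pochMoment a (b + 1) (c + 1) d n)
    (hg : ∀ n m, g (n + 1) m = g n (m + 2)) :
    ∃ F : GaussBorel g, F.S = hgTypeII a b c d := by
  have hlt : ∀ m n, m < n → semiMul (hgTypeII a b c d) g n m = 0 := by
    intro m
    induction m using Nat.strong_induction_on with
    | _ m ih =>
      intro n hmn
      rcases m with _ | _ | m
      · obtain ⟨n, rfl⟩ := Nat.exists_eq_add_of_lt hmn
        rw [zero_add]
        exact semiMul_hgTypeII_zero hc hd h0 n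
      · obtain ⟨n, rfl⟩ := Nat.exists_eq_add_of_lt hmn
        rw [show 0 + 1 + n + 1 = n + 2 by ring]
        exact semiMul_hgTypeII_one hb hc hd h1 n
      -- Row n of the tetradiagonal matrix reaches down only to k = n - 2 > m, where column m
      -- already vanishes.
      · rw [show m + 1 + 1 = m + 2 from rfl, semiMul_hgTypeII_shift hc hd hg]
        refine Finset.sum_eq_zero fun k _ => ?_
        rcases lt_or_ge m k with h | h
        · rw [ih m (by omega) k h, mul_zero]
        · rw [hgJacobi_eq_zero a b c d (Or.inr (by omega)), zero_mul]
  have hdiag : ∀ n, semiMul (hgTypeII a b c d) g n n ≠ 0 := by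
    intro n
    induction n using Nat.strong_induction_on with
    | _ n ih =>
      rcases n with _ | _ | n
      · rw [semiMul_hgTypeII_zero_zero h0]
        exact one_ne_zero
      · rw [zero_add, semiMul_hgTypeII_one_one hc hd h1]
        have : c - b ≠ 0 := sub_ne_zero.2 hcb
        positivity
      -- Only k = n survives, between the band and the triangularity: H_{n+2} = γ_{n+1} H_n.
      · rw [show n + 1 + 1 = n + 2 from rfl, semiMul_hgTypeII_shift hc hd hg,
          Finset.sum_eq_single n, hgJacobi_add_two]
        · exact mul_ne_zero (hγ n).ne' (ih n (by omega))
        · intro k _ hk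
          rcases lt_or_gt_of_ne hk with h | h
          · rw [hgJacobi_eq_zero a b c d (Or.inr (by omega)), zero_mul]
          · rw [hlt n k h, mul_zero]
        · intro h
          exact absurd (Finset.mem_range.2 (by omega)) h
  exact GaussBorel.exists_of_triangular (isLowerUnitriangular_hgTypeII a b c d)
    (fun n m h => hlt m n h) hdiag

end Hypergeometric

/-! ## Values of the type I linear forms at `1` -/

/-- The sequence with ratios `q_{n+1} / q_n = (c_{n+1}+n-1)(c_{n+1}+n)(c_n+n) / ((n+1)(a+n)(b+n))`
and `q_0 = 1`. -/
noncomputable def typeIValue (a b c d : ℝ) : ℕ → ℝ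
  | 0 => 1
  | n + 1 => typeIValue a b c d n *
      ((hgS c d n + n) * (hgS c d n + n + 1) * (hgS c d (n + 1) + n) /
        ((n + 1) * (a + n) * (b + n)))

section TypeIValue

variable {a b c d : ℝ}

theorem typeIValue_pos (ha : 0 < a) (hb : 0 < b) (hc : 0 < c) (hd : 0 < d) (n : ℕ) :
    0 < typeIValue a b c d n := by
  induction n with
  | zero => exact one_pos
  | succ n ih =>
    have h1 := hgS_pos hc hd n
    have h2 := hgS_pos hc hd (n + 1)
    rw [typeIValue]
    positivity

theorem hgS_even (c d : ℝ) (n : ℕ) : hgS c d (2 * n) = c + n := by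
  simp [hgS]

theorem hgS_odd (c d : ℝ) (n : ℕ) : hgS c d (2 * n + 1) = d + n := by
  have : (2 * n + 1) / 2 = n := by omega
  simp [hgS, this]

theorem typeIValue_eq (ha : 0 < a) (hb : 0 < b) (n : ℕ) :
    typeIValue a b c d (2 * n) = 1 / (Nat.factorial (2 * n) : ℝ) *
        (hgPoch c (3 * n) * hgPoch d (3 * n) / (hgPoch a (2 * n) * hgPoch b (2 * n))) ∧
      typeIValue a b c d (2 * n + 1) = 1 / (Nat.factorial (2 * n + 1) : ℝ) *
        (hgPoch c (3 * n + 2) * hgPoch d (3 * n + 1) /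
          (hgPoch a (2 * n + 1) * hgPoch b (2 * n + 1))) := by
  have step : typeIValue a b c d (2 * n) = 1 / (Nat.factorial (2 * n) : ℝ) *
        (hgPoch c (3 * n) * hgPoch d (3 * n) / (hgPoch a (2 * n) * hgPoch b (2 * n))) →
      typeIValue a b c d (2 * n + 1) = 1 / (Nat.factorial (2 * n + 1) : ℝ) *
        (hgPoch c (3 * n + 2) * hgPoch d (3 * n + 1) /
          (hgPoch a (2 * n + 1) * hgPoch b (2 * n + 1))) := by
    intro h
    rw [typeIValue, h, hgS_even, hgS_odd, Nat.factorial_succ, show 3 * n + 2 = 3 * n + 1 + 1 from rfl]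
    simp only [hgPoch_succ]
    have h1 := (hgPoch_pos ha (2 * n)).ne'
    have h2 := (hgPoch_pos hb (2 * n)).ne'
    have h3 : a + 2 * n ≠ 0 := by positivity
    have h4 : b + 2 * n ≠ 0 := by positivity
    push_cast
    field_simp
    ring
  refine (fun h => ⟨h, step h⟩) ?_
  clear step
  induction n with
  | zero => simp [typeIValue, hgPoch_zero]
  | succ n ih =>
    rw [show 2 * (n + 1) = 2 * n + 1 + 1 by ring, typeIValue, typeIValue, ih, hgS_odd, hgS_even,
      show 2 * n + 1 + 1 = 2 * (n + 1) by ring, hgS_even,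
      show 2 * (n + 1) = 2 * n + 1 + 1 by ring, Nat.factorial_succ, Nat.factorial_succ,
      show 3 * (n + 1) = 3 * n + 1 + 1 + 1 by ring]
    simp only [hgPoch_succ]
    have h1 := (hgPoch_pos ha (2 * n)).ne'
    have h2 := (hgPoch_pos hb (2 * n)).ne'
    have h3 : a + 2 * n ≠ 0 := by positivity
    have h4 : b + 2 * n ≠ 0 := by positivity
    have h5 : a + (2 * n + 1) ≠ 0 := by positivity
    have h6 : b + (2 * n + 1) ≠ 0 := by positivity
    push_cast
    field_simp
    ring

/-- Jᵀ = Uᵀ L₂ᵀ L₁ᵀ is applied one bidiagonal factor at a time: y = L₁ᵀq and z = L₂ᵀy are q times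
explicit rational factors, and Uᵀz = q. -/
theorem typeIValue_recurrence (ha : 0 < a) (hb : 0 < b) (hc : 0 < c) (hd : 0 < d) (n : ℕ) :
    (if 1 ≤ n then typeIValue a b c d (n - 1) else 0) +
      hgBeta a b c d n * typeIValue a b c d n +
      hgAlphaSucc a b c d n * typeIValue a b c d (n + 1) +
      hgGammaSucc a b c d n * typeIValue a b c d (n + 2) = typeIValue a b c d n := by
  have hs := hgS_pos hc hd
  set q := typeIValue a b c d with hq
  set y : ℕ → ℝ := fun n => q n * ((hgS c d n + n) / (a + n)) with hy
  set z : ℕ → ℝ := fun n => y n * ((hgS c d (n + 1) + n) / (b + n)) with hz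
  have hqs : ∀ n, q (n + 1) = q n * ((hgS c d n + n) * (hgS c d n + n + 1) * (hgS c d (n + 1) + n) /
        ((n + 1) * (a + n) * (b + n))) := fun n => by rw [hq, typeIValue]
  have hyq : ∀ n, q n + hgLambda a b c d (3 * n + 3) * q (n + 1) = y n := by
    intro n
    have h1 := hs n
    have h2 := hs (n + 1)
    rw [hgLambda_three_mul_add_three, hqs, hy]
    have h3 : hgS c d n + n ≠ 0 := by positivity
    have h4 : hgS c d (n + 1) + n ≠ 0 := by positivity
    have h5 : hgS c d n + n + 1 ≠ 0 := by positivity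
    have h6 : a + n ≠ 0 := by positivity
    have h7 : b + n ≠ 0 := by positivity
    field_simp
    ring
  have hzy : ∀ n, y n + hgLambda a b c d (3 * n + 4) * y (n + 1) = z n := by
    intro n
    have h1 := hs n
    have h2 := hs (n + 1)
    rw [hgLambda_three_mul_add_four, hz, hy]
    dsimp only
    rw [hqs, hgS_add_two]
    have h3 : hgS c d n + n ≠ 0 := by positivity
    have h4 : hgS c d (n + 1) + n ≠ 0 := by positivity
    have h5 : hgS c d (n + 1) + n + 1 ≠ 0 := by positivity
    have h5' : hgS c d n + 1 + n ≠ 0 := by positivity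
    have h6 : a + n ≠ 0 := by positivity
    have h6' : a + (n + 1) ≠ 0 := by positivity
    have h7 : b + n ≠ 0 := by positivity
    push_cast
    field_simp
    ring
  have hqz : ∀ n, q (n + 1) = z n + hgLambda a b c d (3 * n + 5) * z (n + 1) := by
    intro n
    have h1 := hs n
    have h2 := hs (n + 1)
    rw [hgLambda_three_mul_add_five, hz, hy]
    dsimp only
    rw [hqs, hgS_add_two]
    have h3 : hgS c d n + n ≠ 0 := by positivity
    have h3' : hgS c d n + (n + 1) ≠ 0 := by positivity
    have h4 : hgS c d (n + 1) + n ≠ 0 := by positivity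
    have h4' : hgS c d (n + 1) + (n + 1) ≠ 0 := by positivity
    have h5 : hgS c d n + 1 + (n + 1) ≠ 0 := by positivity
    have h5' : hgS c d n + (n + 1) + 1 ≠ 0 := by positivity
    have h6 : a + n ≠ 0 := by positivity
    have h6' : a + (n + 1) ≠ 0 := by positivity
    have h7 : b + n ≠ 0 := by positivity
    have h7' : b + (n + 1) ≠ 0 := by positivity
    push_cast
    field_simp
    ring
  have hqz0 : q 0 = hgLambda a b c d 2 * z 0 := by
    rw [hgLambda_two, hz, hy, hq]
    simp only [typeIValue, hgS_zero, hgS_one, zero_add, Nat.cast_zero, add_zero]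
    field_simp
  rcases n with _ | n
  · have hy0 := hyq 0
    have hy1 := hyq 1
    have hz0 := hzy 0
    norm_num at hy0 hy1 hz0
    simp only [hgBeta, hgAlphaSucc, hgGammaSucc, mul_zero, zero_add, hgLambda_zero, hgLambda_one,
      nonpos_iff_eq_zero, one_ne_zero, if_false]
    rw [← hz0, ← hy0, ← hy1] at hqz0
    linear_combination -hqz0
  · have hy1 := hyq (n + 1)
    have hy2 := hyq (n + 2)
    have hz1 := hzy (n + 1)
    have h := hqz n
    have hz0 := hzy n
    have hy0 := hyq n
    rw [← hz1, ← hz0, ← hy1, ← hy2, ← hy0] at h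
    simp only [hgBeta, hgAlphaSucc, hgGammaSucc, show 1 ≤ n + 1 by omega, if_true,
      Nat.add_sub_cancel, show 3 * (n + 1) = 3 * n + 3 by ring, show 3 * (n + 2) = 3 * n + 6 by ring,
      add_assoc, Nat.reduceAdd] at h ⊢
    linear_combination -h

end TypeIValue
open Filter Topology

/-! ## Gauss's summation theorem -/

/-- The terms of the series `₂F₁(α, β; γ; 1)`. -/
noncomputable def gaussTerm (α β γ : ℝ) (k : ℕ) : ℝ :=
  hgPoch α k * hgPoch β k / (k.factorial * hgPoch γ k)

theorem gaussTerm_zero (α β γ : ℝ) : gaussTerm α β γ 0 = 1 := by simp [gaussTerm, hgPoch_zero]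

section Gauss

variable {α β γ : ℝ}

theorem gaussTerm_succ (hγ : 0 < γ) (k : ℕ) : ((k + 1 : ℕ) : ℝ) * gaussTerm α β γ (k + 1) =
    gaussTerm α β γ k * ((α + k) * (β + k) / (γ + k)) := by
  have h := (hgPoch_pos hγ k).ne'
  have h2 : γ + k ≠ 0 := by positivity
  have h3 : (k.factorial : ℝ) ≠ 0 := by positivity
  simp only [gaussTerm, hgPoch_succ, Nat.factorial_succ]
  push_cast
  field_simp

theorem gaussTerm_add_one (hγ : 0 < γ) (k : ℕ) :
    gaussTerm α β (γ + 1) k = gaussTerm α β γ k * (γ / (γ + k)) := by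
  have h := hgPoch_succ γ k
  rw [hgPoch_succ_left] at h
  have h1 := (hgPoch_pos hγ k).ne'
  have h2 : γ + k ≠ 0 := by positivity
  have h3 : hgPoch (γ + 1) k = hgPoch γ k * (γ + k) / γ := by
    rw [← h]
    field_simp
  rw [gaussTerm, gaussTerm, h3]
  field_simp

/-- Summed over k, the right side leaves only a boundary term, which yields the contiguous relation
between γ and γ + 1. -/
theorem gaussTerm_telescope (hγ : 0 < γ) (k : ℕ) :
    (γ - α - β) * gaussTerm α β γ k - (γ - α) * (γ - β) / γ * gaussTerm α β (γ + 1) k =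
      k * gaussTerm α β γ k - (k + 1 : ℕ) * gaussTerm α β γ (k + 1) := by
  have h2 : γ + k ≠ 0 := by positivity
  rw [gaussTerm_succ hγ, gaussTerm_add_one hγ]
  field_simp
  ring

/-- For large `k`, `k |t_k|` decreases by at least a fixed multiple of `|t_k|`. -/
theorem abs_gaussTerm_decrease (hγ : 0 < γ) (h : 0 < γ - α - β) : ∀ᶠ k : ℕ in atTop,
    (γ - α - β) / 2 * |gaussTerm α β γ k| ≤
      k * |gaussTerm α β γ k| - (k + 1 : ℕ) * |gaussTerm α β γ (k + 1)| := by
  have hlim := tendsto_natCast_atTop_atTop (R := ℝ)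
  filter_upwards [hlim.eventually_ge_atTop (-α), hlim.eventually_ge_atTop (-β),
    -- With s = (γ-α-β)/2, the inequality k - (α+k)(β+k)/(γ+k) ≥ s is equivalent to s k ≥ αβ + γ s,
    -- which is this threshold. The other two make both factors nonnegative.
    hlim.eventually_ge_atTop ((α * β + γ * ((γ - α - β) / 2)) / ((γ - α - β) / 2))] with k h1 h2 h3
  have hα : 0 ≤ α + k := by linarith
  have hβ : 0 ≤ β + k := by linarith
  have hγk : 0 < γ + k := by positivity
  have e : ((k + 1 : ℕ) : ℝ) * |gaussTerm α β γ (k + 1)| =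
      |gaussTerm α β γ k| * ((α + k) * (β + k) / (γ + k)) := by
    have := congrArg abs (gaussTerm_succ (α := α) (β := β) hγ k)
    rwa [abs_mul, abs_mul, abs_of_nonneg (Nat.cast_nonneg _),
      abs_of_nonneg (a := (α + k) * (β + k) / (γ + k)) (by positivity)] at this
  rw [e]
  have h4 : (γ - α - β) / 2 ≤ k - (α + k) * (β + k) / (γ + k) := by
    rw [div_le_iff₀ (by positivity)] at h3
    rw [le_sub_iff_add_le, ← le_sub_iff_add_le', div_le_iff₀ hγk]
    nlinarith
  nlinarith [abs_nonneg (gaussTerm α β γ k)]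

/-- The terms are dominated by the decrements of k |t_k|, so the partial sums telescope to a bounded
quantity. -/
theorem summable_abs_gaussTerm (hγ : 0 < γ) (h : 0 < γ - α - β) :
    Summable fun k => |gaussTerm α β γ k| := by
  obtain ⟨N, hN⟩ := eventually_atTop.1 (abs_gaussTerm_decrease hγ h)
  rw [← summable_nat_add_iff N]
  have hs : 0 < (γ - α - β) / 2 := by positivity
  refine summable_of_sum_range_le (c := N * |gaussTerm α β γ N| / ((γ - α - β) / 2))
    (fun _ => abs_nonneg _) fun n => ?_
  rw [le_div_iff₀ hs]
  have key : ∀ n : ℕ, (∑ i ∈ Finset.range n, |gaussTerm α β γ (i + N)|) * ((γ - α - β) / 2) ≤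
      N * |gaussTerm α β γ N| - (n + N : ℕ) * |gaussTerm α β γ (n + N)| := by
    intro n
    induction n with
    | zero => simp
    | succ n ih =>
      have := hN (n + N) (by omega)
      rw [Finset.sum_range_succ, add_mul, add_right_comm]
      linarith
  have := key n
  have : 0 ≤ ((n + N : ℕ) : ℝ) * |gaussTerm α β γ (n + N)| := by positivity
  linarith [key n]

/-- k |t_k| is eventually decreasing, hence has a limit L ≥ 0; L > 0 would bound |t_k| below by L/k,
and the harmonic series would converge. -/
theorem tendsto_mul_gaussTerm (hγ : 0 < γ) (h : 0 < γ - α - β) :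
    Tendsto (fun k : ℕ => (k : ℝ) * gaussTerm α β γ k) atTop (𝓝 0) := by
  have hsum := summable_abs_gaussTerm hγ h
  obtain ⟨N, hN⟩ := eventually_atTop.1 (abs_gaussTerm_decrease hγ h)
  set u : ℕ → ℝ := fun k => ((k + N : ℕ) : ℝ) * |gaussTerm α β γ (k + N)| with hu
  have hanti : Antitone u := antitone_nat_of_succ_le fun k => by
    have h1 := hN (k + N) (by omega)
    have h2 : 0 ≤ (γ - α - β) / 2 * |gaussTerm α β γ (k + N)| := by positivity
    rw [hu]
    dsimp only
    rw [add_right_comm]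
    linarith
  have hbdd : BddBelow (Set.range u) := ⟨0, by rintro _ ⟨k, rfl⟩; positivity⟩
  have hL := tendsto_atTop_ciInf hanti hbdd
  set L := ⨅ k, u k with hLdef
  have hL0 : 0 ≤ L := le_ciInf fun k => by positivity
  have hLz : L = 0 := by
    by_contra hne
    have hLpos : 0 < L := lt_of_le_of_ne hL0 (Ne.symm hne)
    have hs2 : Summable fun k : ℕ => 1 / ((k + N : ℕ) : ℝ) := by
      refine Summable.of_nonneg_of_le (fun _ => by positivity) (fun k => ?_)
        (((summable_nat_add_iff N).2 hsum).mul_left (1 / L))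
      have hk : L ≤ u k := ciInf_le hbdd k
      rcases Nat.eq_zero_or_pos (k + N) with h0 | hpos
      · rw [h0]
        simp only [Nat.cast_zero, div_zero]
        positivity
      · have : (0 : ℝ) < (k + N : ℕ) := by exact_mod_cast hpos
        rw [div_le_iff₀ this, mul_assoc, div_mul_eq_mul_div, one_mul, one_le_div hLpos, mul_comm]
        exact hk
    exact Real.not_summable_one_div_natCast ((summable_nat_add_iff N).1 hs2)
  rw [hLz] at hL
  rw [← tendsto_add_atTop_iff_nat N]
  refine squeeze_zero_norm (fun k => le_of_eq ?_) hL
  rw [Real.norm_eq_abs, abs_mul, abs_of_nonneg (Nat.cast_nonneg _)]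

theorem tsum_gaussTerm_add_one (hγ : 0 < γ) (h : 0 < γ - α - β) :
    (γ - α - β) * ∑' k, gaussTerm α β γ k =
      (γ - α) * (γ - β) / γ * ∑' k, gaussTerm α β (γ + 1) k := by
  have h1 := (summable_abs_gaussTerm hγ h).of_abs
  have h2 := (summable_abs_gaussTerm (α := α) (β := β) (γ := γ + 1) (by positivity)
    (by linarith)).of_abs
  have hs := (h1.mul_left (γ - α - β)).sub (h2.mul_left ((γ - α) * (γ - β) / γ))
  have hlim := hs.hasSum.tendsto_sum_nat
  simp only [gaussTerm_telescope hγ] at hlim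
  have ht : ∀ n, ∑ k ∈ Finset.range n, ((k : ℝ) * gaussTerm α β γ k -
      (k + 1 : ℕ) * gaussTerm α β γ (k + 1)) = -(n * gaussTerm α β γ n) := by
    intro n
    rw [Finset.sum_range_sub' (fun k : ℕ => (k : ℝ) * gaussTerm α β γ k)]
    simp
  simp only [ht] at hlim
  have h0 := tendsto_nhds_unique hlim (tendsto_mul_gaussTerm hγ h).neg
  simp only [← gaussTerm_telescope hγ] at h0
  rw [(h1.mul_left _).tsum_sub (h2.mul_left _), tsum_mul_left, tsum_mul_left] at h0
  linarith

theorem tsum_gaussTerm_add_nat (hγ : 0 < γ) (h : 0 < γ - α - β) (n : ℕ) :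
    hgPoch γ n * hgPoch (γ - α - β) n * ∑' k, gaussTerm α β γ k =
      hgPoch (γ - α) n * hgPoch (γ - β) n * ∑' k, gaussTerm α β (γ + n) k := by
  induction n with
  | zero => simp [hgPoch_zero]
  | succ n ih =>
    have hγn : 0 < γ + n := by positivity
    have hn : (0 : ℝ) ≤ n := Nat.cast_nonneg n
    have hstep := tsum_gaussTerm_add_one (α := α) (β := β) hγn (by linarith)
    rw [div_mul_eq_mul_div, eq_div_iff hγn.ne'] at hstep
    simp only [hgPoch_succ]
    push_cast
    rw [← add_assoc]
    linear_combination (γ + n) * (γ - α - β + n) * ih + hgPoch (γ - α) n * hgPoch (γ - β) n * hstep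

theorem hgPoch_le_hgPoch {x y : ℝ} (hx : 0 < x) (hxy : x ≤ y) (n : ℕ) :
    hgPoch x n ≤ hgPoch y n := by
  induction n with
  | zero => simp [hgPoch_zero]
  | succ n ih =>
    rw [hgPoch_succ, hgPoch_succ]
    have := hgPoch_pos hx n
    exact mul_le_mul ih (by linarith) (by positivity) ((hgPoch_pos hx n).le.trans ih)

/-- Dominated convergence: raising γ shrinks every term in absolute value, and each term with k ≥ 1
is O(1/(γ+n)). -/
theorem tendsto_tsum_gaussTerm (hγ : 0 < γ) (h : 0 < γ - α - β) :
    Tendsto (fun n : ℕ => ∑' k, gaussTerm α β (γ + n) k) atTop (𝓝 1) := by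
  have hlim : ∑' k : ℕ, (if k = 0 then (1 : ℝ) else 0) = 1 := by
    rw [tsum_eq_single 0 fun k hk => if_neg hk, if_pos rfl]
  rw [← hlim]
  refine tendsto_tsum_of_dominated_convergence (summable_abs_gaussTerm hγ h) (fun k => ?_)
    (Eventually.of_forall fun n k => ?_)
  · rcases k with _ | k
    · simp [gaussTerm_zero]
    · rw [if_neg k.succ_ne_zero]
      have hb : ∀ n : ℕ, ‖gaussTerm α β (γ + n) (k + 1)‖ ≤
          |hgPoch α (k + 1) * hgPoch β (k + 1)| / (((k + 1).factorial : ℝ) * hgPoch (γ + 1) k) *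
            (1 / (γ + n)) := by
        intro n
        have hγn : 0 < γ + n := by positivity
        have h1 := hgPoch_pos (x := γ + n + 1) (by positivity) k
        have h2 := hgPoch_pos (x := γ + 1) (by positivity) k
        have hle : hgPoch (γ + 1) k ≤ hgPoch (γ + n + 1) k :=
          hgPoch_le_hgPoch (by positivity) (by linarith [(Nat.cast_nonneg n : (0 : ℝ) ≤ n)]) k
        rw [gaussTerm, hgPoch_succ_left (γ + n), Real.norm_eq_abs, abs_div,
          abs_of_pos (a := ((k + 1).factorial : ℝ) * _) (by positivity), div_mul_div_comm, mul_one]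
        refine div_le_div_of_nonneg_left (abs_nonneg _) (by positivity) ?_
        rw [mul_assoc, mul_comm (hgPoch (γ + 1) k)]
        gcongr
      refine squeeze_zero_norm hb ?_
      rw [← mul_zero (|hgPoch α (k + 1) * hgPoch β (k + 1)| /
        (((k + 1).factorial : ℝ) * hgPoch (γ + 1) k))]
      refine Tendsto.const_mul _ ?_
      simp only [one_div]
      exact (tendsto_atTop_add_const_left _ γ tendsto_natCast_atTop_atTop).inv_tendsto_atTop
  · have h1 := hgPoch_pos hγ k
    have hle : hgPoch γ k ≤ hgPoch (γ + n) k :=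
      hgPoch_le_hgPoch hγ (by linarith [(Nat.cast_nonneg n : (0 : ℝ) ≤ n)]) k
    have h2 := h1.trans_le hle
    rw [gaussTerm, gaussTerm, Real.norm_eq_abs, abs_div, abs_div,
      abs_of_pos (a := (k.factorial : ℝ) * hgPoch γ k) (by positivity),
      abs_of_pos (a := (k.factorial : ℝ) * hgPoch (γ + n) k) (by positivity)]
    exact div_le_div_of_nonneg_left (abs_nonneg _) (by positivity) (by gcongr)

theorem GammaSeq_eq (x : ℝ) (n : ℕ) :
    Real.GammaSeq x n = (n : ℝ) ^ x * n.factorial / hgPoch x (n + 1) := by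
  have h : ∀ m, hgPoch x m = ∏ j ∈ Finset.range m, (x + j) := by
    intro m
    induction m with
    | zero => simp [hgPoch_zero]
    | succ m ih => rw [hgPoch_succ, Finset.prod_range_succ, ih]
  rw [Real.GammaSeq, h]

/-- Gauss's summation theorem. -/
theorem tsum_gaussTerm (hγ : 0 < γ) (h : 0 < γ - α - β) (hα : 0 < γ - α) (hβ : 0 < γ - β) :
    ∑' k, gaussTerm α β γ k =
      Real.Gamma γ * Real.Gamma (γ - α - β) / (Real.Gamma (γ - α) * Real.Gamma (γ - β)) := by
  have hratio := ((Real.GammaSeq_tendsto_Gamma γ).mul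
    (Real.GammaSeq_tendsto_Gamma (γ - α - β))).div ((Real.GammaSeq_tendsto_Gamma (γ - α)).mul
    (Real.GammaSeq_tendsto_Gamma (γ - β)))
    (mul_pos (Real.Gamma_pos_of_pos hα) (Real.Gamma_pos_of_pos hβ)).ne'
  -- Euler's sequence for Γ(x) has (x)_{n+1} in its denominator, hence the shift to n + 1. The
  -- powers of n cancel because γ + (γ-α-β) = (γ-α) + (γ-β), so the limiting expression is a
  -- constant sequence.
  have hF := ((tendsto_tsum_gaussTerm hγ h).comp (tendsto_add_atTop_nat 1)).mul hratio
  rw [one_mul] at hF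
  refine tendsto_nhds_unique (tendsto_const_nhds.congr' ?_) hF
  filter_upwards [eventually_gt_atTop 0] with n hn
  have hn' : (0 : ℝ) < n := by exact_mod_cast hn
  have key := tsum_gaussTerm_add_nat hγ h (n + 1)
  have hp1 := (hgPoch_pos hγ (n + 1)).ne'
  have hp2 := (hgPoch_pos h (n + 1)).ne'
  have hp3 := (hgPoch_pos hα (n + 1)).ne'
  have hp4 := (hgPoch_pos hβ (n + 1)).ne'
  have hpow : (n : ℝ) ^ γ * (n : ℝ) ^ (γ - α - β) = (n : ℝ) ^ (γ - α) * (n : ℝ) ^ (γ - β) := by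
    rw [← Real.rpow_add hn', ← Real.rpow_add hn']
    congr 1
    ring
  have h5 : (n : ℝ) ^ (γ - α) ≠ 0 := (Real.rpow_pos_of_pos hn' _).ne'
  have h6 : (n : ℝ) ^ (γ - β) ≠ 0 := (Real.rpow_pos_of_pos hn' _).ne'
  have h7 : (n.factorial : ℝ) ≠ 0 := by positivity
  simp only [Function.comp_apply, Pi.div_apply, GammaSeq_eq]
  generalize ∑' k, gaussTerm α β γ k = F at *
  generalize ∑' k, gaussTerm α β (γ + (n + 1 : ℕ)) k = F' at *
  have e : (n : ℝ) ^ γ * n.factorial / hgPoch γ (n + 1) *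
        ((n : ℝ) ^ (γ - α - β) * n.factorial / hgPoch (γ - α - β) (n + 1)) /
      ((n : ℝ) ^ (γ - α) * n.factorial / hgPoch (γ - α) (n + 1) *
        ((n : ℝ) ^ (γ - β) * n.factorial / hgPoch (γ - β) (n + 1))) =
      hgPoch (γ - α) (n + 1) * hgPoch (γ - β) (n + 1) /
        (hgPoch γ (n + 1) * hgPoch (γ - α - β) (n + 1)) := by
    have : (n : ℝ) ^ γ * n.factorial / hgPoch γ (n + 1) *
        ((n : ℝ) ^ (γ - α - β) * n.factorial / hgPoch (γ - α - β) (n + 1)) =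
        ((n : ℝ) ^ γ * (n : ℝ) ^ (γ - α - β)) * (n.factorial * n.factorial) /
          (hgPoch γ (n + 1) * hgPoch (γ - α - β) (n + 1)) := by
      field_simp
    rw [this, hpow]
    field_simp
  rw [e, mul_div_assoc', eq_div_iff (mul_ne_zero hp1 hp2)]
  linear_combination key

end Gauss

/-! ## Moments of the hypergeometric weights -/

/-- The sum is a pointwise limit of measurable partial sums, and the integral of its norm is at most
the finite sum of the integrals. -/
theorem integrable_tsum_of_summable_integral_norm {X : Type*} [MeasurableSpace X] {μ : Measure X}
    {F : ℕ → X → ℝ} (hF : ∀ k, Integrable (F k) μ) (hs : Summable fun k => ∫ x, ‖F k x‖ ∂μ)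
    {f : X → ℝ} (hf : ∀ᵐ x ∂μ, HasSum (fun k => F k x) (f x)) : Integrable f μ := by
  have hlt : ∑' k, ∫⁻ x, ‖F k x‖ₑ ∂μ < ⊤ := by
    have h : ∀ k, ∫⁻ x, ‖F k x‖ₑ ∂μ = ENNReal.ofReal (∫ x, ‖F k x‖ ∂μ) := fun k => by
      rw [ofReal_integral_norm_eq_lintegral_enorm (hF k)]
    rw [tsum_congr h, ← ENNReal.ofReal_tsum_of_nonneg
      (fun k => integral_nonneg fun _ => norm_nonneg _) hs]
    exact ENNReal.ofReal_lt_top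
  refine ⟨?_, ?_⟩
  · refine aestronglyMeasurable_of_tendsto_ae atTop
      (f := fun n x => ∑ k ∈ Finset.range n, F k x) (fun n => ?_) ?_
    · exact Finset.aestronglyMeasurable_fun_sum _ fun k _ => (hF k).1
    · filter_upwards [hf] with x hx using hx.tendsto_sum_nat
  · refine lt_of_le_of_lt ?_ hlt
    rw [← lintegral_tsum fun k => (hF k).1.enorm]
    refine lintegral_mono_ae ?_
    filter_upwards [hf] with x hx
    rw [← hx.tsum_eq]
    exact enorm_tsum_le_tsum_enorm

theorem beta_integrable_and_integral {u v : ℝ} (hu : 0 < u) (hv : 0 < v) :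
    Integrable (fun x : ℝ => x ^ (u - 1) * (1 - x) ^ (v - 1)) (volume.restrict (Set.Ioo 0 1)) ∧
      ∫ x in Set.Ioo (0 : ℝ) 1, x ^ (u - 1) * (1 - x) ^ (v - 1) =
        Real.Gamma u * Real.Gamma v / Real.Gamma (u + v) := by
  have hconv := Complex.betaIntegral_convergent (u := u) (v := v) (by simpa) (by simpa)
  rw [intervalIntegrable_iff_integrableOn_Ioc_of_le (by simp), ← integrableOn_Icc_iff_integrableOn_Ioc,
    integrableOn_Icc_iff_integrableOn_Ioo, IntegrableOn] at hconv
  have hcongr : ∀ x ∈ Set.Ioo (0 : ℝ) 1,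
      ((x : ℂ) ^ ((u : ℂ) - 1) * (1 - (x : ℂ)) ^ ((v : ℂ) - 1)).re =
        x ^ (u - 1) * (1 - x) ^ (v - 1) := by
    intro x hx
    have h1 : (x : ℂ) ^ ((u : ℂ) - 1) = ((x ^ (u - 1) : ℝ) : ℂ) := by
      rw [Complex.ofReal_cpow hx.1.le]
      push_cast
      rfl
    have h2 : (1 - (x : ℂ)) ^ ((v : ℂ) - 1) = (((1 - x) ^ (v - 1) : ℝ) : ℂ) := by
      rw [Complex.ofReal_cpow (by linarith [hx.2])]
      push_cast
      rfl
    rw [h1, h2, ← Complex.ofReal_mul, Complex.ofReal_re]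
  refine ⟨?_, ?_⟩
  · refine (hconv.re).congr ?_
    filter_upwards [ae_restrict_mem measurableSet_Ioo] with x hx using hcongr x hx
  · have h := ProbabilityTheory.beta_eq_betaIntegralReal u v hu hv
    rw [ProbabilityTheory.beta] at h
    rw [h, Complex.betaIntegral, intervalIntegral.integral_of_le (by norm_num),
      integral_Ioc_eq_integral_Ioo, ← RCLike.re_to_complex, ← integral_re hconv]
    exact setIntegral_congr_fun measurableSet_Ioo fun x hx => (hcongr x hx).symm

theorem Gamma_add_nat {x : ℝ} (hx : 0 < x) (n : ℕ) :
    Real.Gamma (x + n) = hgPoch x n * Real.Gamma x := by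
  induction n with
  | zero => simp [hgPoch_zero]
  | succ n ih =>
    rw [Nat.cast_succ, ← add_assoc, Real.Gamma_add_one (by positivity), ih, hgPoch_succ]
    ring

theorem hasSum_ordinaryHypergeometric (α β : ℝ) {δ : ℝ} (hδ : 0 < δ) {x : ℝ} (hx0 : 0 ≤ x)
    (hx1 : x < 1) :
    HasSum (fun k => gaussTerm α β δ k * x ^ k) (ordinaryHypergeometric α β δ x) := by
  have hterm : ∀ k : ℕ, ((k.factorial : ℝ)⁻¹ * (ascPochhammer ℝ k).eval α *
      (ascPochhammer ℝ k).eval β * ((ascPochhammer ℝ k).eval δ)⁻¹) • x ^ k =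
        gaussTerm α β δ k * x ^ k := fun k => by
    rw [gaussTerm, smul_eq_mul, div_eq_mul_inv, mul_inv]
    simp only [hgPoch]
    ring
  have hsum : Summable fun k => gaussTerm α β δ k * x ^ k := by
    have hratio : Tendsto (fun k : ℕ => |(α + k) / (δ + k) * ((β + k) / (1 + k)) * x|) atTop
        (𝓝 x) := by
      have h1 := tendsto_add_mul_div_add_mul_atTop_nhds α δ (1 : ℝ) one_ne_zero
      have h2 := tendsto_add_mul_div_add_mul_atTop_nhds β 1 (1 : ℝ) one_ne_zero
      have h3 := ((h1.mul h2).mul_const x).abs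
      simpa [abs_of_nonneg hx0] using h3
    obtain ⟨r, hxr, hr⟩ := exists_between hx1
    refine summable_of_ratio_norm_eventually_le hr ?_
    filter_upwards [hratio.eventually_le_const hxr] with k hk
    have hstep : gaussTerm α β δ (k + 1) * x ^ (k + 1) =
        (α + k) / (δ + k) * ((β + k) / (1 + k)) * x * (gaussTerm α β δ k * x ^ k) := by
      have h1 := gaussTerm_succ (α := α) (β := β) hδ k
      rw [mul_comm, ← eq_div_iff (by positivity)] at h1
      have h2 : δ + k ≠ 0 := by positivity
      rw [h1, pow_succ]
      push_cast
      field_simp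
      ring
    rw [hstep, norm_mul, Real.norm_eq_abs]
    exact mul_le_mul_of_nonneg_right hk (norm_nonneg _)
  rw [ordinaryHypergeometric_eq_tsum]
  simp only [hterm]
  exact hsum.hasSum

/-- The integral of `x^(u-1) (1-x)^(δ-1) ₂F₁(α, β; δ; 1-x)` over the unit interval. -/
theorem hypergeometric_integrable_and_integral {α β δ u : ℝ} (hδ : 0 < δ) (hu : 0 < u)
    (h : 0 < u + δ - α - β) (hα : 0 < u + δ - α) (hβ : 0 < u + δ - β) :
    Integrable (fun x : ℝ => x ^ (u - 1) * (1 - x) ^ (δ - 1) *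
        ordinaryHypergeometric α β δ (1 - x)) (volume.restrict (Set.Ioo 0 1)) ∧
      ∫ x in Set.Ioo (0 : ℝ) 1, x ^ (u - 1) * (1 - x) ^ (δ - 1) *
        ordinaryHypergeometric α β δ (1 - x) = Real.Gamma u * Real.Gamma δ *
          Real.Gamma (u + δ - α - β) / (Real.Gamma (u + δ - α) * Real.Gamma (u + δ - β)) := by
  set F : ℕ → ℝ → ℝ := fun k x => gaussTerm α β δ k * (x ^ (u - 1) * (1 - x) ^ (δ + k - 1)) with hF
  have hbeta := fun k : ℕ => beta_integrable_and_integral hu (v := δ + k) (by positivity)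
  have hFint : ∀ k, Integrable (F k) (volume.restrict (Set.Ioo 0 1)) :=
    fun k => (hbeta k).1.const_mul _
  -- The Beta integral of the k-th term replaces (δ)_k by (u+δ)_k, so integration gives ₂F₁(α, β;
  -- u+δ; 1).
  have hval : ∀ k : ℕ, gaussTerm α β δ k *
      (Real.Gamma u * Real.Gamma (δ + k) / Real.Gamma (u + (δ + k))) =
        Real.Gamma u * Real.Gamma δ / Real.Gamma (u + δ) * gaussTerm α β (u + δ) k := by
    intro k
    have hud : 0 < u + δ := by positivity
    rw [← add_assoc, Gamma_add_nat hδ, Gamma_add_nat hud, gaussTerm, gaussTerm]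
    have h1 := (hgPoch_pos hδ k).ne'
    have h2 := (hgPoch_pos hud k).ne'
    have h3 := (Real.Gamma_pos_of_pos hud).ne'
    field_simp
  have hnorm : ∀ k, ∫ x in Set.Ioo (0 : ℝ) 1, ‖F k x‖ =
      Real.Gamma u * Real.Gamma δ / Real.Gamma (u + δ) * |gaussTerm α β (u + δ) k| := by
    intro k
    have hG : 0 < Real.Gamma u * Real.Gamma δ / Real.Gamma (u + δ) :=
      div_pos (mul_pos (Real.Gamma_pos_of_pos hu) (Real.Gamma_pos_of_pos hδ))
        (Real.Gamma_pos_of_pos (by positivity))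
    have hG2 : 0 < Real.Gamma u * Real.Gamma (δ + k) / Real.Gamma (u + (δ + k)) :=
      div_pos (mul_pos (Real.Gamma_pos_of_pos hu) (Real.Gamma_pos_of_pos (by positivity)))
        (Real.Gamma_pos_of_pos (by positivity))
    rw [← abs_of_pos hG, ← abs_mul, ← hval, abs_mul, abs_of_pos hG2, ← (hbeta k).2,
      ← integral_const_mul]
    refine setIntegral_congr_fun measurableSet_Ioo fun x hx => ?_
    have h1 := Real.rpow_nonneg hx.1.le (u - 1)
    have h2 := Real.rpow_nonneg (sub_nonneg.2 hx.2.le) (δ + k - 1)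
    rw [hF]
    simp only [Real.norm_eq_abs, abs_mul, abs_of_nonneg h1, abs_of_nonneg h2]
  have hsum : Summable fun k => ∫ x in Set.Ioo (0 : ℝ) 1, ‖F k x‖ := by
    simp only [hnorm]
    exact (summable_abs_gaussTerm (by positivity) h).mul_left _
  have hae : ∀ᵐ x ∂volume.restrict (Set.Ioo (0 : ℝ) 1), HasSum (fun k => F k x)
      (x ^ (u - 1) * (1 - x) ^ (δ - 1) * ordinaryHypergeometric α β δ (1 - x)) := by
    filter_upwards [ae_restrict_mem measurableSet_Ioo] with x hx
    have hx1 : 0 < 1 - x := sub_pos.2 hx.2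
    refine ((hasSum_ordinaryHypergeometric α β hδ hx1.le (by linarith [hx.1])).mul_left
      (x ^ (u - 1) * (1 - x) ^ (δ - 1))).congr_fun fun k => ?_
    rw [hF]
    dsimp only
    rw [show δ + k - 1 = δ - 1 + k by ring, Real.rpow_add_natCast hx1.ne']
    ring
  refine ⟨integrable_tsum_of_summable_integral_norm hFint hsum hae, ?_⟩
  have h1 := (hasSum_integral_of_summable_integral_norm hFint hsum).tsum_eq
  rw [integral_congr_ae (hae.mono fun x hx => hx.tsum_eq.symm), ← h1]
  have h2 : ∀ k, ∫ x in Set.Ioo (0 : ℝ) 1, F k x =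
      Real.Gamma u * Real.Gamma δ / Real.Gamma (u + δ) * gaussTerm α β (u + δ) k := fun k => by
    rw [← hval, ← (hbeta k).2, ← integral_const_mul]
  rw [tsum_congr h2, tsum_mul_left, tsum_gaussTerm (by positivity) h hα hβ]
  have h3 := (Real.Gamma_pos_of_pos (show 0 < u + δ by positivity)).ne'
  field_simp

theorem measurable_hgDensity (a b c d : ℝ) : Measurable fun x : ℝ => ENNReal.ofReal
    (Real.Gamma c * Real.Gamma d / (Real.Gamma a * Real.Gamma b * Real.Gamma (c + d - a - b))
      * x ^ (a - 1) * (1 - x) ^ (c + d - a - b - 1)) := by fun_prop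

section Moments

variable {a b c d : ℝ}

theorem hgMeasure_integrable_and_integral (ha : 0 < a) (hb : 0 < b) (hc : 0 < c) (hd : 0 < d)
    (hδ : 0 < c + d - a - b) {f : ℝ → ℝ} {I : ℝ}
    (hf : Integrable (fun x : ℝ => x ^ (a - 1) * (1 - x) ^ (c + d - a - b - 1) * f x)
      (volume.restrict (Set.Ioo 0 1)))
    (hI : ∫ x in Set.Ioo (0 : ℝ) 1, x ^ (a - 1) * (1 - x) ^ (c + d - a - b - 1) * f x = I) :
    Integrable f (hgMeasure a b c d) ∧ ∫ x, f x ∂(hgMeasure a b c d) = Real.Gamma c * Real.Gamma d /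
      (Real.Gamma a * Real.Gamma b * Real.Gamma (c + d - a - b)) * I := by
  have hK : 0 < Real.Gamma c * Real.Gamma d /
      (Real.Gamma a * Real.Gamma b * Real.Gamma (c + d - a - b)) :=
    div_pos (mul_pos (Real.Gamma_pos_of_pos hc) (Real.Gamma_pos_of_pos hd))
      (mul_pos (mul_pos (Real.Gamma_pos_of_pos ha) (Real.Gamma_pos_of_pos hb))
        (Real.Gamma_pos_of_pos hδ))
  have hmeas := measurable_hgDensity a b c d
  unfold hgMeasure
  set K := Real.Gamma c * Real.Gamma d /
    (Real.Gamma a * Real.Gamma b * Real.Gamma (c + d - a - b))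
  -- The endpoints are null, and on the open interval the series at 1 - x converges and the powers
  -- are harmless.
  rw [Measure.restrict_congr_set (Ioo_ae_eq_Icc (a := (0 : ℝ)) (b := 1)).symm]
  have hlt : ∀ᵐ x ∂volume.restrict (Set.Ioo (0 : ℝ) 1),
      ENNReal.ofReal (K * x ^ (a - 1) * (1 - x) ^ (c + d - a - b - 1)) < ⊤ :=
    Eventually.of_forall fun _ => ENNReal.ofReal_lt_top
  have hcongr : (fun x : ℝ => K * (x ^ (a - 1) * (1 - x) ^ (c + d - a - b - 1) * f x))
      =ᵐ[volume.restrict (Set.Ioo (0 : ℝ) 1)] fun x =>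
        (ENNReal.ofReal (K * x ^ (a - 1) * (1 - x) ^ (c + d - a - b - 1))).toReal • f x := by
    filter_upwards [ae_restrict_mem measurableSet_Ioo] with x hx
    have h1 := Real.rpow_nonneg hx.1.le (a - 1)
    have h2 := Real.rpow_nonneg (sub_nonneg.2 hx.2.le) (c + d - a - b - 1)
    rw [ENNReal.toReal_ofReal (by positivity), smul_eq_mul]
    ring
  rw [integrable_withDensity_iff_integrable_smul' hmeas hlt,
    integral_withDensity_eq_integral_toReal_smul hmeas hlt, ← integral_congr_ae hcongr,
    integral_const_mul, hI]
  exact ⟨(hf.const_mul K).congr hcongr, rfl⟩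

/-- With u = a + n the Gauss sum has gamma arguments b + n above and c + n, d + n below, and the
normalization of the measure makes the moment of order 0 equal to 1. -/
theorem hgW₁_moment (ha : 0 < a) (hb : 0 < b) (hc : 0 < c) (hd : 0 < d)
    (hδ : 0 < c + d - a - b) (n : ℕ) :
    Integrable (fun x => x ^ n * hgW₁ a b c d x) (hgMeasure a b c d) ∧
      ∫ x, x ^ n * hgW₁ a b c d x ∂(hgMeasure a b c d) = pochMoment a b c d n := by
  have hn : (0 : ℝ) ≤ n := Nat.cast_nonneg n
  have e1 : a + n + (c + d - a - b) - (c - b) - (d - b) = b + n := by ring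
  have e2 : a + n + (c + d - a - b) - (c - b) = d + n := by ring
  have e3 : a + n + (c + d - a - b) - (d - b) = c + n := by ring
  have key := hypergeometric_integrable_and_integral (α := c - b) (β := d - b) hδ
    (u := a + n) (by positivity) (by rw [e1]; positivity) (by rw [e2]; positivity)
    (by rw [e3]; positivity)
  rw [e1, e2, e3] at key
  have hcongr : ∀ x ∈ Set.Ioo (0 : ℝ) 1, x ^ (a + n - 1) * (1 - x) ^ (c + d - a - b - 1) *
      ordinaryHypergeometric (c - b) (d - b) (c + d - a - b) (1 - x) =
        x ^ (a - 1) * (1 - x) ^ (c + d - a - b - 1) * (x ^ n * hgW₁ a b c d x) := by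
    intro x hx
    rw [hgW₁, show a + n - 1 = a - 1 + n by ring, Real.rpow_add_natCast hx.1.ne']
    ring
  have hres := hgMeasure_integrable_and_integral ha hb hc hd hδ
    (f := fun x => x ^ n * hgW₁ a b c d x)
    (key.1.congr ((ae_restrict_mem measurableSet_Ioo).mono hcongr))
    ((setIntegral_congr_fun measurableSet_Ioo hcongr).symm.trans key.2)
  refine ⟨hres.1, hres.2.trans ?_⟩
  rw [Gamma_add_nat ha, Gamma_add_nat hb, Gamma_add_nat hc, Gamma_add_nat hd, pochMoment]
  have h1 := (Real.Gamma_pos_of_pos ha).ne'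
  have h2 := (Real.Gamma_pos_of_pos hb).ne'
  have h3 := (Real.Gamma_pos_of_pos hc).ne'
  have h4 := (Real.Gamma_pos_of_pos hd).ne'
  have h5 := (Real.Gamma_pos_of_pos hδ).ne'
  have h6 := (hgPoch_pos hc n).ne'
  have h7 := (hgPoch_pos hd n).ne'
  field_simp

theorem hgW₂_moment (ha : 0 < a) (hb : 0 < b) (hc : 0 < c) (hd : 0 < d)
    (hδ : 0 < c + d - a - b) (n : ℕ) :
    Integrable (fun x => x ^ n * hgW₂ a b c d x) (hgMeasure a b c d) ∧
      ∫ x, x ^ n * hgW₂ a b c d x ∂(hgMeasure a b c d) = pochMoment a (b + 1) (c + 1) d n := by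
  have hn : (0 : ℝ) ≤ n := Nat.cast_nonneg n
  have e1 : a + n + (c + d - a - b) - (c - b) - (d - b - 1) = b + 1 + n := by ring
  have e2 : a + n + (c + d - a - b) - (c - b) = d + n := by ring
  have e3 : a + n + (c + d - a - b) - (d - b - 1) = c + 1 + n := by ring
  have key := hypergeometric_integrable_and_integral (α := c - b) (β := d - b - 1) hδ
    (u := a + n) (by positivity) (by rw [e1]; positivity) (by rw [e2]; positivity)
    (by rw [e3]; positivity)
  rw [e1, e2, e3] at key
  have hcongr : ∀ x ∈ Set.Ioo (0 : ℝ) 1, c / b * (x ^ (a + n - 1) *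
      (1 - x) ^ (c + d - a - b - 1) *
      ordinaryHypergeometric (c - b) (d - b - 1) (c + d - a - b) (1 - x)) =
        x ^ (a - 1) * (1 - x) ^ (c + d - a - b - 1) * (x ^ n * hgW₂ a b c d x) := by
    intro x hx
    rw [hgW₂, show a + n - 1 = a - 1 + n by ring, Real.rpow_add_natCast hx.1.ne']
    ring
  have hres := hgMeasure_integrable_and_integral ha hb hc hd hδ
    (f := fun x => x ^ n * hgW₂ a b c d x)
    ((key.1.const_mul (c / b)).congr ((ae_restrict_mem measurableSet_Ioo).mono hcongr))
    ((setIntegral_congr_fun measurableSet_Ioo hcongr).symm.trans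
      ((integral_const_mul _ _).trans (congrArg (c / b * ·) key.2)))
  refine ⟨hres.1, hres.2.trans ?_⟩
  have hb1 : 0 < b + 1 := by positivity
  have hc1 : 0 < c + 1 := by positivity
  rw [Gamma_add_nat ha, Gamma_add_nat hb1, Gamma_add_nat hc1, Gamma_add_nat hd, pochMoment,
    Real.Gamma_add_one hb.ne', Real.Gamma_add_one hc.ne']
  have h1 := (Real.Gamma_pos_of_pos ha).ne'
  have h2 := (Real.Gamma_pos_of_pos hb).ne'
  have h3 := (Real.Gamma_pos_of_pos hc).ne'
  have h4 := (Real.Gamma_pos_of_pos hd).ne'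
  have h5 := (Real.Gamma_pos_of_pos hδ).ne'
  have h6 := (hgPoch_pos hc1 n).ne'
  have h7 := (hgPoch_pos hd n).ne'
  field_simp

theorem hgXi_moment (ha : 0 < a) (hb : 0 < b) (hc : 0 < c) (hd : 0 < d)
    (hδ : 0 < c + d - a - b) (n m : ℕ) :
    Integrable (fun x => x ^ n * hgXi a b c d m x) (hgMeasure a b c d) := by
  have h : (fun x => x ^ n * hgXi a b c d m x) = fun x => x ^ (n + m / 2) *
      if Even m then hgW₁ a b c d x else hgW₂ a b c d x := by
    funext x
    rw [hgXi, pow_add, mul_assoc]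
  rw [h]
  split_ifs
  · exact (hgW₁_moment ha hb hc hd hδ _).1
  · exact (hgW₂_moment ha hb hc hd hδ _).1

theorem hgMoment_zero (ha : 0 < a) (hb : 0 < b) (hc : 0 < c) (hd : 0 < d)
    (hδ : 0 < c + d - a - b) (n : ℕ) : hgMoment a b c d n 0 = pochMoment a b c d n := by
  rw [← (hgW₁_moment ha hb hc hd hδ n).2]
  simp [hgMoment, hgXi]

theorem hgMoment_one (ha : 0 < a) (hb : 0 < b) (hc : 0 < c) (hd : 0 < d)
    (hδ : 0 < c + d - a - b) (n : ℕ) :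
    hgMoment a b c d n 1 = pochMoment a (b + 1) (c + 1) d n := by
  rw [← (hgW₂_moment ha hb hc hd hδ n).2]
  simp [hgMoment, hgXi]

/-- No convergence is involved: the weight values are mere factors, so the type I recurrence holds
formally at every real x. -/
theorem hgXi_add_two (a b c d : ℝ) (m : ℕ) (x : ℝ) :
    hgXi a b c d (m + 2) x = x * hgXi a b c d m x := by
  have h : (m + 2) / 2 = m / 2 + 1 := by omega
  simp only [hgXi, h, Nat.even_add, even_two, iff_true]
  ring

theorem hgMoment_shift (a b c d : ℝ) (n m : ℕ) :
    hgMoment a b c d (n + 1) m = hgMoment a b c d n (m + 2) := by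
  simp only [hgMoment, Matrix.of_apply, hgXi_add_two]
  congr 1
  funext x
  ring

end Moments

/-! ## Random walks -/

theorem semiMul_diagonal_conj (u v : ℕ → ℝ) (T : Matrix ℕ ℕ ℝ) (n m : ℕ) :
    semiMul (semiMul (Matrix.diagonal u) T) (Matrix.diagonal v) n m = u n * T n m * v m := by
  rw [semiMul_diagonal_right, semiMul_diagonal_left]

/-- Normalizing at `1` the solutions of a recurrence with nonnegative coefficients yields a random
walk system. -/
theorem isRandomWalkSystem_of_recurrence {T : Matrix ℕ ℕ ℝ} {f : ℕ → ℝ → ℝ} (N : ℕ → ℕ)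
    (hT : ∀ n m, 0 ≤ T n m) (hN : ∀ n m, N n ≤ m → T n m = 0) (hf : ∀ n, 0 < f n 1)
    (hrec : ∀ n x, ∑ k ∈ Finset.range (N n), T n k * f k x = x * f n x) :
    IsRandomWalkSystem (semiMul (semiMul (Matrix.diagonal fun n => 1 / f n 1) T)
      (Matrix.diagonal fun n => f n 1)) (fun n x => f n x / f n 1) := by
  have hsum : ∀ n x, ∑ k ∈ Finset.range (N n), 1 / f n 1 * T n k * f k 1 * (f k x / f k 1) =
      x * (f n x / f n 1) := by
    intro n x
    rw [← mul_div_assoc, ← hrec, Finset.sum_div]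
    refine Finset.sum_congr rfl fun k _ => ?_
    have h1 := (hf n).ne'
    have h2 := (hf k).ne'
    field_simp
  refine ⟨⟨fun n m => ?_, fun n => ?_⟩, fun n => ?_, fun n => div_self (hf n).ne', fun n x => ?_⟩
  · rw [semiMul_diagonal_conj]
    exact mul_nonneg (mul_nonneg (one_div_nonneg.2 (hf n).le) (hT n m)) (hf m).le
  -- The row sums are the recurrence at x = 1, where all normalized functions are 1.
  · have h := hsum n 1
    rw [div_self (hf n).ne', mul_one] at h
    have h2 : ∀ m, semiMul (semiMul (Matrix.diagonal fun n => 1 / f n 1) T)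
        (Matrix.diagonal fun n => f n 1) n m = 1 / f n 1 * T n m * f m 1 * (f m 1 / f m 1) :=
      fun m => by rw [semiMul_diagonal_conj, div_self (hf m).ne', mul_one]
    have h3 : HasSum (fun m => 1 / f n 1 * T n m * f m 1 * (f m 1 / f m 1))
        (∑ k ∈ Finset.range (N n), 1 / f n 1 * T n k * f k 1 * (f k 1 / f k 1)) :=
      hasSum_sum_of_ne_finset_zero fun m hm => by
        rw [hN n m (by simpa using hm)]
        ring
    rw [h] at h3
    exact h3.congr_fun h2
  · refine (Finset.range (N n)).finite_toSet.subset fun m hm => ?_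
    by_contra h
    refine hm ?_
    rw [semiMul_diagonal_conj, hN n m (by simpa using h)]
    ring
  · rw [finsum_eq_sum_of_support_subset (s := Finset.range (N n)), ← hsum n x]
    · exact Finset.sum_congr rfl fun k _ => by rw [semiMul_diagonal_conj]
    · intro m hm
      by_contra h
      refine hm ?_
      dsimp only
      rw [semiMul_diagonal_conj, hN n m (by simpa using h)]
      ring

/-! ## Type II polynomials -/

namespace GaussBorel

variable {g : Matrix ℕ ℕ ℝ}

theorem eval_B (F : GaussBorel g) (n : ℕ) (x : ℝ) :
    (F.B n).eval x = ∑ i ∈ Finset.range (n + 1), F.S n i * x ^ i := by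
  simp [B, eval_finsetSum]

theorem coeff_B (F : GaussBorel g) (n k : ℕ) : (F.B n).coeff k = F.S n k := by
  rw [B, finsetSum_coeff]
  simp only [coeff_C_mul, coeff_X_pow, mul_ite, mul_one, mul_zero, Finset.sum_ite_eq,
    Finset.mem_range]
  split_ifs with h
  · rfl
  · exact (F.S_lower.2 n k (by omega)).symm

theorem natDegree_B (F : GaussBorel g) (n : ℕ) : (F.B n).natDegree = n := by
  refine natDegree_eq_of_le_of_coeff_ne_zero ?_ ?_
  · exact natDegree_le_iff_coeff_eq_zero.2 fun k hk => by rw [coeff_B, F.S_lower.2 n k hk]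
  · rw [coeff_B, F.S_lower.1]
    exact one_ne_zero

theorem leadingCoeff_B (F : GaussBorel g) (n : ℕ) : (F.B n).leadingCoeff = 1 := by
  rw [leadingCoeff, natDegree_B, coeff_B, F.S_lower.1]

/-- A monic polynomial of positive degree tends to +∞, so a value ≤ 0 at 1 would force a root in [1,
∞). -/
theorem eval_B_one_pos (F : GaussBorel g) {n : ℕ}
    (h : ∀ x : ℝ, (F.B n).IsRoot x → x ∈ Set.Ioo (0 : ℝ) 1) : 0 < (F.B n).eval 1 := by
  rcases Nat.eq_zero_or_pos n with rfl | hn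
  · simp [eval_B, F.S_lower.1]
  · by_contra hle
    have hdeg : 0 < (F.B n).degree := natDegree_pos_iff_degree_pos.1 (by rwa [natDegree_B])
    have hlim := (F.B n).tendsto_atTop_of_leadingCoeff_nonneg hdeg
      (by rw [leadingCoeff_B]; exact zero_le_one)
    obtain ⟨y, hy, hy1⟩ := ((hlim.eventually_gt_atTop 0).and (eventually_ge_atTop 1)).exists
    obtain ⟨x, hx, hx0⟩ := intermediate_value_Icc hy1 (F.B n).continuous.continuousOn
      ⟨not_lt.1 hle, hy.le⟩
    exact absurd (h x hx0).2 (not_lt.2 hx.1)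

/-- The recurrence `J B = x B`. -/
theorem jacobi_eval_B (F : GaussBorel g) (n N : ℕ) (hN : ∀ m, N ≤ m → F.jacobi n m = 0) (x : ℝ) :
    ∑ k ∈ Finset.range N, F.jacobi n k * (F.B k).eval x = x * (F.B n).eval x := by
  -- M exceeds all degrees in sight; one more index allows the constant term to be split off.
  set M := n + N + 1 with hM
  have ext : ∀ k, k < M → (F.B k).eval x = ∑ i ∈ Finset.range M, F.S k i * x ^ i := fun k h => by
    rw [eval_B]
    exact Finset.sum_subset (Finset.range_mono h) fun i _ hi => by
      rw [F.S_lower.2 k i (by simpa [Nat.succ_le_iff] using hi), zero_mul]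
  have ext' : ∀ k, k < M → (F.B k).eval x = ∑ i ∈ Finset.range (M + 1), F.S k i * x ^ i :=
    fun k h => by
      rw [Finset.sum_range_succ, ← ext k h, F.S_lower.2 k M h]
      ring
  have hcol : ∀ i, ∑ k ∈ Finset.range N, F.jacobi n k * F.S k i =
      semiMul F.S shiftMatrix n i := fun i => by
    rw [← F.semiMul_jacobi_S, semiMul_eq_sum _ _ i (Finset.range N) fun k hk =>
      hN k (by simpa using hk)]
  have hzero : semiMul F.S shiftMatrix n 0 = 0 := by simp [semiMul, shiftMatrix]
  have hsucc : ∀ i, semiMul F.S shiftMatrix n (i + 1) = F.S n i := fun i => by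
    rw [semiMul, Matrix.of_apply, finsum_eq_single _ i fun k hk => by
      simp [shiftMatrix, hk.symm]]
    simp [shiftMatrix]
  calc ∑ k ∈ Finset.range N, F.jacobi n k * (F.B k).eval x
      = ∑ k ∈ Finset.range N, ∑ i ∈ Finset.range (M + 1), F.jacobi n k * F.S k i * x ^ i :=
        Finset.sum_congr rfl fun k hk => by
          rw [ext' k (by have := Finset.mem_range.1 hk; omega), Finset.mul_sum]
          exact Finset.sum_congr rfl fun i _ => (mul_assoc _ _ _).symm
    _ = ∑ i ∈ Finset.range (M + 1), semiMul F.S shiftMatrix n i * x ^ i := by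
        rw [Finset.sum_comm]
        exact Finset.sum_congr rfl fun i _ => by rw [← Finset.sum_mul, hcol]
    _ = x * (F.B n).eval x := by
        rw [Finset.sum_range_succ', hzero, zero_mul, add_zero, ext n (by omega), Finset.mul_sum]
        exact Finset.sum_congr rfl fun i _ => by rw [hsucc, pow_succ]; ring

/-! ## Type I linear forms -/

theorem q_eq_sum {a b c d : ℝ} (F : GaussBorel (hgMoment a b c d)) (n : ℕ) (x : ℝ) :
    F.q n x = ∑ j ∈ Finset.range (n + 1), F.typeI n j * hgXi a b c d j x := by
  simp only [q, A₁, A₂, eval_mul, eval_C, eval_finsetSum, typeI_apply, hgXi]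
  rw [← mul_assoc, ← mul_assoc, Finset.mul_sum, Finset.mul_sum, ← Finset.sum_add_distrib]
  refine Finset.sum_congr rfl fun j _ => ?_
  split_ifs
  · simp only [eval_mul, eval_C, eval_pow, eval_X, eval_zero]
    ring
  · simp only [eval_mul, eval_C, eval_pow, eval_X, eval_zero]
    ring

theorem St_one_zero (F : GaussBorel g) : F.St 1 0 = -(semiMul F.S g 0 1 / F.H 0) := by
  have h := congrFun (congrFun (semiMul_lowerInv _ F.St_lower) 1) 0
  rw [F.St_lower.semiMul_eq_sum, Finset.sum_range_succ, Finset.sum_range_one, F.St_lower.1,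
    (lowerInv_isLowerUnitriangular F.St).1] at h
  have h2 := F.semiMul_S_apply 0 1
  rw [h2, mul_div_cancel_left₀ _ (F.H_ne_zero 0)]
  rw [Matrix.one_apply_ne one_ne_zero] at h
  linarith

theorem hgXi_zero_one (a b c d : ℝ) : hgXi a b c d 0 1 = 1 := by simp [hgXi, hgW₁]

theorem hgXi_one_one (a b c d : ℝ) : hgXi a b c d 1 1 = c / b := by simp [hgXi, hgW₂]

end GaussBorel

-- The recurrence at n expresses q_{n+2} through earlier values because γ_{n+1} ≠ 0, so only q₀ and
-- q₁ have to be computed. There S̃₁₀ = -1, as both weights have mass 1, and the factor c - b of H₁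
-- cancels against c/b - 1.
open GaussBorel in
theorem typeI_at_one_eq {a b c d : ℝ} (ha : 0 < a) (hb : 0 < b) (hc : 0 < c) (hd : 0 < d)
    (hδ : 0 < c + d - a - b) (hcb : c ≠ b) (hγ : ∀ n, 0 < hgGammaSucc a b c d n)
    (F : GaussBorel (hgMoment a b c d)) (hS : F.S = hgTypeII a b c d)
    (hrec : ∀ n, ∑ k ∈ Finset.range (n + 3), hgJacobi a b c d k n * F.q k 1 = F.q n 1) (n : ℕ) :
    F.q n 1 = typeIValue a b c d n := by
  have h0 := hgMoment_zero ha hb hc hd hδ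
  have h1 := hgMoment_one ha hb hc hd hδ
  have hH0 : F.H 0 = 1 := by
    rw [← F.semiMul_S_self, hS, semiMul_hgTypeII_zero_zero h0]
  have hH1 : F.H 1 = a * (c - b) / (d * c * (c + 1)) := by
    rw [← F.semiMul_S_self, hS, semiMul_hgTypeII_one_one hc hd h1]
  have hSt : F.St 1 0 = -1 := by
    rw [St_one_zero, hH0, F.S_lower.semiMul_eq_sum, zero_add, Finset.sum_range_one, F.S_lower.1, h1]
    simp [pochMoment, hgPoch_zero]
  induction n using Nat.strong_induction_on with
  | _ n ih =>
    rcases n with _ | _ | n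
    · rw [q_eq_sum, zero_add, Finset.sum_range_one, typeI_apply, hH0, F.St_lower.1, hgXi_zero_one,
        typeIValue]
      norm_num
    · rw [q_eq_sum, Finset.sum_range_succ, Finset.sum_range_one, typeI_apply, typeI_apply, zero_add,
        hSt, F.St_lower.1, hH1, hgXi_zero_one, hgXi_one_one, typeIValue, typeIValue, hgS_zero,
        zero_add, hgS_one]
      have hne : c - b ≠ 0 := sub_ne_zero.2 hcb
      simp only [Nat.cast_zero, add_zero, zero_add]
      field_simp
      ring
    · have hr := hrec n
      rw [sum_hgJacobi_column a b c d fun k => F.q k 1] at hr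
      have ht := typeIValue_recurrence ha hb hc hd n
      have e0 : (if 1 ≤ n then F.q (n - 1) 1 else 0) =
          if 1 ≤ n then typeIValue a b c d (n - 1) else 0 := by
        split_ifs
        · exact ih _ (by omega)
        · rfl
      rw [e0, ih n (by omega), ih (n + 1) (by omega)] at hr
      refine mul_left_cancel₀ (hγ n).ne' ?_
      linarith

/-! ### The main theorem -/

theorem mainTheorem4 (a b c d : ℝ)
    -- the parameter region that ensures perfectness
    (ha : 0 < a) (hb : 0 < b) (hδ : 0 < c + d - a - b)
    (hda : ∀ k : ℕ, d - a ≠ -(k : ℝ)) (hdb : ∀ k : ℕ, d - b ≠ -(k : ℝ))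
    (hca : ∀ k : ℕ, c + 1 - a ≠ -(k : ℝ)) (hcb : ∀ k : ℕ, c - b ≠ -(k : ℝ))
    -- the standing assumption that makes the Jacobi matrix nonnegative
    (hd_max : max a b < d) (hc_a : a ≤ c) (hc_b : b ≤ c + 1) :
    -- the moments are finite and the moment matrix has a unique Gauss--Borel factorization
    (∀ n m : ℕ, Integrable (fun x : ℝ => x ^ n * hgXi a b c d m x) (hgMeasure a b c d)) ∧
    ∃ F : GaussBorel (hgMoment a b c d), (∀ G : GaussBorel (hgMoment a b c d), G = F) ∧
      -- the Jacobi matrix, which is nonnegative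
      (∀ n, F.jacobi n (n + 1) = 1 ∧
        F.jacobi n n = hgBeta a b c d n ∧
        F.jacobi (n + 1) n = hgAlphaSucc a b c d n ∧
        F.jacobi (n + 2) n = hgGammaSucc a b c d n) ∧
      (∀ n m, n + 1 < m ∨ m + 2 < n → F.jacobi n m = 0) ∧
      (∀ n m, 0 ≤ F.jacobi n m) ∧
      -- type II
      ((∀ (n : ℕ) (x : ℝ), (F.B n).IsRoot x → x ∈ Set.Ioo (0 : ℝ) 1) →
        (∀ n, 0 < (F.B n).eval 1) ∧
        IsStochastic F.PII ∧
        (∀ n, F.PII n (n + 1) = (F.B (n + 1)).eval 1 / (F.B n).eval 1 ∧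
          F.PII n n = hgBeta a b c d n ∧
          F.PII (n + 1) n = (F.B n).eval 1 / (F.B (n + 1)).eval 1 * hgAlphaSucc a b c d n ∧
          F.PII (n + 2) n = (F.B n).eval 1 / (F.B (n + 2)).eval 1 * hgGammaSucc a b c d n) ∧
        (∀ n m, n + 1 < m ∨ m + 2 < n → F.PII n m = 0) ∧
        IsRandomWalkSystem F.PII (fun n x => (F.B n).eval x / (F.B n).eval 1)) ∧
      -- type I
      (∀ n, 0 < F.q n 1) ∧
      (∀ n, F.q (2 * n) 1 = 1 / (Nat.factorial (2 * n) : ℝ) *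
          (hgPoch c (3 * n) * hgPoch d (3 * n) / (hgPoch a (2 * n) * hgPoch b (2 * n))) ∧
        F.q (2 * n + 1) 1 = 1 / (Nat.factorial (2 * n + 1) : ℝ) *
          (hgPoch c (3 * n + 2) * hgPoch d (3 * n + 1) /
            (hgPoch a (2 * n + 1) * hgPoch b (2 * n + 1)))) ∧
      IsStochastic F.PI ∧
      (∀ n, F.PI n (n + 2) = F.q (n + 2) 1 / F.q n 1 * hgGammaSucc a b c d n ∧
        F.PI n (n + 1) = F.q (n + 1) 1 / F.q n 1 * hgAlphaSucc a b c d n ∧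
        F.PI n n = hgBeta a b c d n ∧
        F.PI (n + 1) n = F.q n 1 / F.q (n + 1) 1) ∧
      (∀ n m, n + 2 < m ∨ m + 1 < n → F.PI n m = 0) ∧
      IsRandomWalkSystem F.PI (fun n x => F.q n x / F.q n 1) := by
  have hda' : a < d := (le_max_left a b).trans_lt hd_max
  have hdb' : b < d := (le_max_right a b).trans_lt hd_max
  have hc : 0 < c := ha.trans_le hc_a
  have hd : 0 < d := ha.trans hda'
  have hca' : a < c + 1 := by linarith
  -- Two instances of c - b ∉ -ℕ₀ are used: k = 0 gives H₁ ≠ 0, and k = 1 makes b ≤ c + 1 strict, as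
  -- γ > 0 requires.
  have hcb0 : c ≠ b := fun h => hcb 0 (by simp [h])
  have hcb' : b < c + 1 := lt_of_le_of_ne hc_b fun h => hcb 1 (by rw [h]; simp)
  have hγ := hgGammaSucc_pos ha hb hc hd hda' hca' hdb' hcb'
  have hnonneg := hgJacobi_nonneg (hgLambda_nonneg ha hb hc hd hda' hc_a hdb' hcb')
  refine ⟨hgXi_moment ha hb hc hd hδ, ?_⟩
  obtain ⟨F, hS⟩ := exists_gaussBorel_of_moments ha hb hc hd hcb0 hγ
    (hgMoment_zero ha hb hc hd hδ) (hgMoment_one ha hb hc hd hδ) (hgMoment_shift a b c d)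
  have hJ : F.jacobi = hgJacobi a b c d := F.jacobi_eq (rowFinite_hgJacobi a b c d)
    (by rw [hS, hgJacobi_semiMul_hgTypeII hc hd])
  have hB : ∀ n x, ∑ k ∈ Finset.range (n + 2), F.jacobi n k * (F.B k).eval x =
      x * (F.B n).eval x := fun n x => F.jacobi_eval_B n (n + 2) (fun m hm => by
    rw [hJ, hgJacobi_eq_zero a b c d (Or.inl (by omega))]) x
  have hq : ∀ n x, ∑ k ∈ Finset.range (n + 3), F.jacobi k n * F.q k x = x * F.q n x := by
    intro n x
    simp only [GaussBorel.q_eq_sum]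
    refine F.transpose_jacobi_linearForm (hgMoment_shift a b c d)
      (fun j => hgXi_add_two a b c d j x) n _ fun m hm => ?_
    rw [hJ, hgJacobi_eq_zero a b c d (Or.inr (by
      have : n + 3 ≤ m := by simpa using hm
      omega))]
  have hq1 : ∀ n, F.q n 1 = typeIValue a b c d n :=
    typeI_at_one_eq ha hb hc hd hδ hcb0 hγ F hS fun n => by rw [← hJ, hq, one_mul]
  have hqpos : ∀ n, 0 < F.q n 1 := fun n => by
    rw [hq1]
    exact typeIValue_pos ha hb hc hd n
  have hPI : ∀ n m, F.PI n m = 1 / F.q n 1 * hgJacobi a b c d m n * F.q m 1 := fun n m => by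
    rw [GaussBorel.PI, semiMul_diagonal_conj, Matrix.transpose_apply, hJ]
  have hPII : ∀ n m, F.PII n m = 1 / (F.B n).eval 1 * hgJacobi a b c d n m * (F.B m).eval 1 :=
    fun n m => by rw [GaussBorel.PII, semiMul_diagonal_conj, hJ]
  have hwalkI : IsRandomWalkSystem F.PI (fun n x => F.q n x / F.q n 1) :=
    isRandomWalkSystem_of_recurrence (T := F.jacobi.transpose) (fun n => n + 3)
      (fun n m => by rw [Matrix.transpose_apply, hJ]; exact hnonneg m n)
      (fun n m h => by
        rw [Matrix.transpose_apply, hJ, hgJacobi_eq_zero a b c d (Or.inr (by omega))]) hqpos hq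
  -- All remaining goals are entries of J or of its conjugates, now known explicitly.
  refine ⟨F, F.unique, fun n => ?_, fun n m h => ?_, fun n m => ?_, fun hroots => ?_, hqpos,
    fun n => ?_, hwalkI.1, fun n => ?_, fun n m h => ?_, hwalkI⟩
  · rw [hJ]
    exact ⟨hgJacobi_succ a b c d n, hgJacobi_self a b c d n, hgJacobi_add_one a b c d n,
      hgJacobi_add_two a b c d n⟩
  · rw [hJ, hgJacobi_eq_zero a b c d h]
  · rw [hJ]
    exact hnonneg n m
  · have hBpos : ∀ n, 0 < (F.B n).eval 1 := fun n => F.eval_B_one_pos (hroots n)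
    have hwalkII : IsRandomWalkSystem F.PII (fun n x => (F.B n).eval x / (F.B n).eval 1) :=
      isRandomWalkSystem_of_recurrence (T := F.jacobi) (f := fun n x => (F.B n).eval x)
        (fun n => n + 2) (fun n m => by rw [hJ]; exact hnonneg n m)
        (fun n m h => by rw [hJ, hgJacobi_eq_zero a b c d (Or.inl (by omega))]) hBpos hB
    refine ⟨hBpos, hwalkII.1, fun n => ?_, fun n m h => ?_, hwalkII⟩
    · have h0 := (hBpos n).ne'
      rw [hPII, hPII, hPII, hPII, hgJacobi_succ, hgJacobi_self, hgJacobi_add_one, hgJacobi_add_two]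
      refine ⟨by ring, ?_, by ring, by ring⟩
      field_simp
    · rw [hPII, hgJacobi_eq_zero a b c d h, mul_zero, zero_mul]
  · rw [hq1, hq1]
    exact typeIValue_eq ha hb n
  · have h0 := (hqpos n).ne'
    rw [hPI, hPI, hPI, hPI, hgJacobi_succ, hgJacobi_self, hgJacobi_add_one, hgJacobi_add_two]
    refine ⟨by ring, by ring, ?_, by ring⟩
    field_simp
  · rw [hPI, hgJacobi_eq_zero a b c d (by omega), mul_zero, zero_mul]
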